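/- **Theorem 4.** Let $n,m\ge 2$ be integers. Let $g_0$ denote both semi-Euclidean metrics $(g_0)_{ij}=\epsilon_i\delta_{ij}$ on $\mathbb{R}^n$ ($\epsilon_i=\pm1$) and $(g_0)_{ij}=\epsilon'_i\delta_{ij}$ on $\mathbb{R}^m$ ($\epsilon'_i=\pm1$). Fix nonzero vectors $\alpha\in\mathbb{R}^n$, $\beta\in\mathbb{R}^m$, put $$\xi(x)=\sum_{i=1}^n\alpha_ix_i,\qquad \zeta(y)=\sum_{j=1}^m\beta_jy_j,\qquad \|\alpha\|^2=\sum_i\epsilon_i\alpha_i^2,\qquad \|\beta\|^2=\sum_j\epsilon'_j\beta_j^2 ,$$ and let $\theta\ge 0$, $\lambda\in\mathbb{R}$. Let $\varphi,f,h,\tau,u:\mathbb{R}\to\mathbb{R}$ be smooth functions with $\varphi$ and $\tau$ nowhere zero and $f>0$. On $\mathbb{R}^n\times\mathbb{R}^m$, with projections $\pi$ and $\sigma$ onto the two factors, consider the warped product metric with base $(\mathbb{R}^n,(\varphi\circ\xi)^{-2}g_0)$, fiber $(\mathbb{R}^m,(\tau\circ\zeta)^{-2}g_0)$ and warping function $f\circ\xi$,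 $$g=\pi^*\big((\varphi\circ\xi)^{-2}g_0\big)+(f\circ\xi\circ\pi)^2\,\sigma^*\big((\tau\circ\zeta)^{-2}g_0\big),$$ the potential $H=h\circ\xi\circ\pi$ and the real-valued map $U=u\circ\zeta\circ\sigma$. Then $U$ is non-constant and $(\mathbb{R}^n\times\mathbb{R}^m,g,H,U,\lambda)$ is a gradient Ricci-harmonic soliton with constant $\theta$, that is, $$\mathrm{Ric}_g+\mathrm{Hess}_g H-\theta\,\nabla U\otimes\nabla U=\lambda g,\qquad \mathrm{tr}_g(\nabla dU)-g(\nabla U,\nabla H)=0,$$ if and only if $u$ is non-constant and, for all $\xi,\zeta\in\mathbb{R}$, with $\varphi,f,h$ evaluated at $\xi$ and $\tau,u$ evaluated at $\zeta$, $$(n-2)\frac{\varphi''}{\varphi}-m\frac{f''}{f}-2m\frac{\varphi'}{\varphi}\frac{f'}{f}+h''+2\frac{\varphi'}{\varphi}h'=0,$$ $$\Big[\frac{\varphi''}{\varphi}-(n-1)\Big(\frac{\varphi'}{\varphi}\Big)^2+m\frac{\varphi'}{\varphi}\frac{f'}{f}-\frac{\varphi'}{\varphi}h'\Big]\|\alpha\|^2=\frac{\lambda}{\varphi^2},$$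 $$\big[f''\varphi^2f-(n-2)\varphi'\varphi ff'+(m-1)(f')^2\varphi^2-f'f\varphi^2h'\big]\|\alpha\|^2+\lambda f^2=\big[\tau\tau''-(m-1)(\tau')^2\big]\|\beta\|^2,$$ $$(m-2)\frac{\tau''}{\tau}-\theta(u')^2=0,$$ $$\big[\tau^2u''-(m-2)\tau\tau'u'\big]\|\beta\|^2=0.$$ -/

import Mathlib

open scoped ContDiff

noncomputable section

/-! Semi-Riemannian geometry in global coordinates. A point of the coordinate space is a function
`x : ι → ℝ`, and a metric is given by its matrix of components `g x` at each point `x`. -/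

namespace GRHS

section Coordinates

variable {ι : Type*} [Fintype ι] [DecidableEq ι]

/-- The partial derivative `∂F/∂xᵢ` at `x`. -/
def partialDeriv (i : ι) (F : (ι → ℝ) → ℝ) (x : ι → ℝ) : ℝ :=
  fderiv ℝ F x (Pi.single i 1)

/-- A semi-Riemannian metric on `ℝ^ι`: a smooth field of symmetric nondegenerate bilinear forms
(the index is then constant, since `ℝ^ι` is connected). -/
structure IsSemiRiemannianMetric (g : (ι → ℝ) → Matrix ι ι ℝ) : Prop where
  smooth : ∀ i j, ContDiff ℝ ∞ (fun x => g x i j)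
  symm : ∀ x, (g x).IsSymm
  nondegenerate : ∀ x, IsUnit (g x).det

/-- Christoffel symbols `Γᵏᵢⱼ = ½ ∑ₗ gᵏˡ (∂ᵢ gⱼₗ + ∂ⱼ gᵢₗ - ∂ₗ gᵢⱼ)` of the Levi-Civita
connection. -/
def christoffel (g : (ι → ℝ) → Matrix ι ι ℝ) (k i j : ι) (x : ι → ℝ) : ℝ :=
  (1 / 2 : ℝ) * ∑ l, (g x)⁻¹ k l *
    (partialDeriv i (fun y => g y j l) x + partialDeriv j (fun y => g y i l) x
      - partialDeriv l (fun y => g y i j) x)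

/-- Components of the curvature tensor, `R(∂ᵢ, ∂ⱼ) ∂ₖ = ∑ₗ Rˡₖᵢⱼ ∂ₗ` with
`R(X, Y) = ∇_X ∇_Y - ∇_Y ∇_X - ∇_[X,Y]`. -/
def riemann (g : (ι → ℝ) → Matrix ι ι ℝ) (l k i j : ι) (x : ι → ℝ) : ℝ :=
  partialDeriv i (christoffel g l j k) x - partialDeriv j (christoffel g l i k) x
    + ∑ p, (christoffel g l i p x * christoffel g p j k x
        - christoffel g l j p x * christoffel g p i k x)

/-- The Ricci tensor `Ric(∂ⱼ, ∂ₖ) = tr (X ↦ R(X, ∂ⱼ) ∂ₖ)` (positive on round spheres). -/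
def ricci (g : (ι → ℝ) → Matrix ι ι ℝ) (j k : ι) (x : ι → ℝ) : ℝ :=
  ∑ i, riemann g i k i j x

/-- The Hessian `∇dF` of a function. -/
def hess (g : (ι → ℝ) → Matrix ι ι ℝ) (F : (ι → ℝ) → ℝ) (i j : ι) (x : ι → ℝ) : ℝ :=
  partialDeriv i (partialDeriv j F) x - ∑ k, christoffel g k i j x * partialDeriv k F x

/-- The tension field `tr_g (∇du)` of a real-valued map. -/
def tension (g : (ι → ℝ) → Matrix ι ι ℝ) (u : (ι → ℝ) → ℝ) (x : ι → ℝ) : ℝ :=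
  ∑ i, ∑ j, (g x)⁻¹ i j * hess g u i j x

/-- The gradient vector field `(∇F)ⁱ = ∑ⱼ gⁱʲ ∂ⱼF`. -/
def grad (g : (ι → ℝ) → Matrix ι ι ℝ) (F : (ι → ℝ) → ℝ) (x : ι → ℝ) : ι → ℝ :=
  fun i => ∑ j, (g x)⁻¹ i j * partialDeriv j F x

/-- The scalar product `g(X, Y)` of two tangent vectors at `x`. -/
def metricInner (g : (ι → ℝ) → Matrix ι ι ℝ) (x : ι → ℝ) (X Y : ι → ℝ) : ℝ :=
  ∑ i, ∑ j, g x i j * X i * Y j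

/-- Gradient Ricci-harmonic soliton on `(ℝ^ι, g)` with a real-valued harmonic map `u`, potential
`h` and constants `θ ≥ 0`, `lam`:
`Ric + Hess h - θ ∇u ⊗ ∇u = lam g` and `τ_g u = g(∇u, ∇h)`.
Here `∇u ⊗ ∇u` is the covariant 2-tensor with components `∂ᵢu ∂ⱼu`. -/
structure IsGRHS (g : (ι → ℝ) → Matrix ι ι ℝ) (h u : (ι → ℝ) → ℝ) (θ lam : ℝ) : Prop where
  metric : IsSemiRiemannianMetric g
  smooth_potential : ContDiff ℝ ∞ h
  smooth_map : ContDiff ℝ ∞ u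
  theta_nonneg : 0 ≤ θ
  ricci_eq : ∀ x i j,
    ricci g i j x + hess g h i j x - θ * (partialDeriv i u x * partialDeriv j u x)
      = lam * g x i j
  tension_eq : ∀ x, tension g u x - metricInner g x (grad g u x) (grad g h x) = 0

/-- The linear function `x ↦ ∑ᵢ aᵢ xᵢ`, invariant under a codimension one translation group. -/
def linFun (a x : ι → ℝ) : ℝ := ∑ i, a i * x i

/-- `‖a‖² = ∑ᵢ εᵢ aᵢ²`, with respect to the semi-Euclidean metric of signature `ε`. -/
def sqNorm (ε a : ι → ℝ) : ℝ := ∑ i, ε i * a i ^ 2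

/-- The metric `ψ⁻² g₀` conformal to the semi-Euclidean metric `(g₀)ᵢⱼ = εᵢ δᵢⱼ`. -/
def conformalMetric (ε : ι → ℝ) (ψ : (ι → ℝ) → ℝ) (x : ι → ℝ) : Matrix ι ι ℝ :=
  ((ψ x) ^ 2)⁻¹ • Matrix.diagonal ε

end Coordinates

section Warped

variable {ι κ : Type*}

/-- The projection `π : B × F → B`. -/
def baseProj (p : ι ⊕ κ → ℝ) : ι → ℝ := fun i => p (Sum.inl i)

/-- The projection `σ : B × F → F`. -/
def fiberProj (p : ι ⊕ κ → ℝ) : κ → ℝ := fun j => p (Sum.inr j)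

/-- The warped product metric `π^* g_B + (f ∘ π)² σ^* g_F` on `ℝ^ι × ℝ^κ = ℝ^(ι ⊕ κ)`. -/
def warpedMetric (gB : (ι → ℝ) → Matrix ι ι ℝ) (f : (ι → ℝ) → ℝ)
    (gF : (κ → ℝ) → Matrix κ κ ℝ) (p : ι ⊕ κ → ℝ) : Matrix (ι ⊕ κ) (ι ⊕ κ) ℝ :=
  Matrix.fromBlocks (gB (baseProj p)) 0 0 ((f (baseProj p)) ^ 2 • gF (fiberProj p))

end Warped

end GRHS

end

/-! On a warped product, the soliton equations for a potential pulled back from the base and a map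
pulled back from the fiber split into a base equation `Ric_B + Hess H - (m / f) Hess f = λ g_B`,
a fiber equation `Ric_F - θ du ⊗ du = c(x) g_F` and harmonicity of `u` on the fiber; the mixed
components vanish identically. For a conformally flat metric `ψ⁻² g₀` and functions of a single
linear form `∑ αᵢ xᵢ`, each tensor equation takes the form `A αᵢ αⱼ + B (g₀)ᵢⱼ = 0`. In dimension
at least two the nondegenerate form `g₀` is not a multiple of the rank one form `α ⊗ α`, so this
means `A = B = 0`, which are the ordinary differential equations of the theorem. -/

noncomputable section

namespace GRHS

section PartialDerivatives

variable {ι : Type*} [DecidableEq ι] {F G : (ι → ℝ) → ℝ} {x : ι → ℝ}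

lemma partialDeriv_const (i : ι) (c : ℝ) (x : ι → ℝ) : partialDeriv i (fun _ => c) x = 0 := by
  simp [partialDeriv]

lemma partialDeriv_neg [Finite ι] (i : ι) (F : (ι → ℝ) → ℝ) (x : ι → ℝ) :
    partialDeriv i (fun y => -F y) x = -partialDeriv i F x := by
  cases nonempty_fintype ι
  simp [partialDeriv, fderiv_fun_neg]

lemma partialDeriv_add [Finite ι] (i : ι) (hF : DifferentiableAt ℝ F x)
    (hG : DifferentiableAt ℝ G x) :
    partialDeriv i (fun y => F y + G y) x = partialDeriv i F x + partialDeriv i G x := by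
  cases nonempty_fintype ι
  simp [partialDeriv, fderiv_fun_add hF hG]

lemma partialDeriv_sub [Finite ι] (i : ι) (hF : DifferentiableAt ℝ F x)
    (hG : DifferentiableAt ℝ G x) :
    partialDeriv i (fun y => F y - G y) x = partialDeriv i F x - partialDeriv i G x := by
  cases nonempty_fintype ι
  simp [partialDeriv, fderiv_fun_sub hF hG]

lemma partialDeriv_sum [Finite ι] {κ : Type*} {s : Finset κ} {F : κ → (ι → ℝ) → ℝ} (i : ι)
    (hF : ∀ k ∈ s, DifferentiableAt ℝ (F k) x) :
    partialDeriv i (fun y => ∑ k ∈ s, F k y) x = ∑ k ∈ s, partialDeriv i (F k) x := by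
  cases nonempty_fintype ι
  simp [partialDeriv, fderiv_fun_sum hF]

lemma partialDeriv_mul [Finite ι] (i : ι) (hF : DifferentiableAt ℝ F x)
    (hG : DifferentiableAt ℝ G x) :
    partialDeriv i (fun y => F y * G y) x
      = partialDeriv i F x * G x + F x * partialDeriv i G x := by
  cases nonempty_fintype ι
  simp [partialDeriv, fderiv_fun_mul hF hG]
  ring

lemma partialDeriv_const_mul [Finite ι] (i : ι) (c : ℝ) (hF : DifferentiableAt ℝ F x) :
    partialDeriv i (fun y => c * F y) x = c * partialDeriv i F x := by
  simp [partialDeriv_mul i (differentiableAt_const c) hF, partialDeriv_const]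

lemma partialDeriv_comp [Finite ι] (i : ι) {φ : ℝ → ℝ} (hφ : DifferentiableAt ℝ φ (F x))
    (hF : DifferentiableAt ℝ F x) :
    partialDeriv i (fun y => φ (F y)) x = deriv φ (F x) * partialDeriv i F x := by
  cases nonempty_fintype ι
  change fderiv ℝ (φ ∘ F) x _ = _
  rw [(hφ.hasDerivAt.comp_hasFDerivAt x hF.hasFDerivAt).fderiv]
  rfl

lemma partialDeriv_div [Finite ι] (i : ι) (hF : DifferentiableAt ℝ F x)
    (hG : DifferentiableAt ℝ G x) (hx : G x ≠ 0) :
    partialDeriv i (fun y => F y / G y) x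
      = partialDeriv i F x / G x - F x * partialDeriv i G x / G x ^ 2 := by
  cases nonempty_fintype ι
  simp only [div_eq_mul_inv]
  rw [partialDeriv_mul i hF (hG.fun_inv hx),
    partialDeriv_comp (φ := fun s => s⁻¹) i (differentiableAt_inv hx) hG, deriv_inv]
  ring

variable [Fintype ι]

lemma contDiff_partialDeriv (hF : ContDiff ℝ ∞ F) (i : ι) : ContDiff ℝ ∞ (partialDeriv i F) :=
  (hF.fderiv_right (m := ∞) (by simp)).clm_apply contDiff_const

lemma partialDeriv_comm (hF : ContDiff ℝ ∞ F) (i j : ι) (x : ι → ℝ) :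
    partialDeriv i (partialDeriv j F) x = partialDeriv j (partialDeriv i F) x := by
  have hF' : Differentiable ℝ (fderiv ℝ F) :=
    (hF.fderiv_right (m := ∞) (by simp)).differentiable (by simp)
  have hsymm : IsSymmSndFDerivAt ℝ F x :=
    (contDiff_infty.1 hF 2).contDiffAt.isSymmSndFDerivAt (by simp)
  have hsnd (i j : ι) : partialDeriv i (partialDeriv j F) x
      = fderiv ℝ (fderiv ℝ F) x (Pi.single i 1) (Pi.single j 1) := by
    change fderiv ℝ (fun y => fderiv ℝ F y (Pi.single j 1)) x (Pi.single i 1) = _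
    rw [fderiv_clm_apply (hF' x) (differentiableAt_const _)]
    simp
  rw [hsnd, hsnd, hsymm.eq]

end PartialDerivatives

section LinFun

variable {ι : Type*} [Fintype ι]

lemma contDiff_linFun (a : ι → ℝ) : ContDiff ℝ ∞ (linFun a) :=
  ContDiff.sum fun i _ => contDiff_const.mul (contDiff_apply ℝ ℝ i)

lemma contDiff_comp_linFun {φ : ℝ → ℝ} (hφ : ContDiff ℝ ∞ φ) (a : ι → ℝ) :
    ContDiff ℝ ∞ fun y => φ (linFun a y) :=
  hφ.comp (contDiff_linFun a)

lemma linFun_surjective {a : ι → ℝ} (ha : a ≠ 0) : Function.Surjective (linFun a) := by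
  classical
  intro s
  obtain ⟨i, hi⟩ := Function.ne_iff.1 ha
  have hi : a i ≠ 0 := hi
  exact ⟨Pi.single i (s / a i), by simp [linFun, Pi.single_apply, mul_div_cancel₀ _ hi]⟩

variable [DecidableEq ι]

lemma partialDeriv_linFun (a : ι → ℝ) (i : ι) (x : ι → ℝ) :
    partialDeriv i (linFun a) x = a i := by
  have h : HasFDerivAt (linFun a)
      (∑ k, a k • ContinuousLinearMap.proj (R := ℝ) (φ := fun _ : ι => ℝ) k) x :=
    HasFDerivAt.fun_sum fun k _ => (hasFDerivAt_apply k x).const_mul (a k)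
  rw [partialDeriv, h.fderiv]
  simp [Pi.single_apply]

lemma partialDeriv_comp_linFun {φ : ℝ → ℝ} (hφ : Differentiable ℝ φ) (a : ι → ℝ) (i : ι)
    (x : ι → ℝ) :
    partialDeriv i (fun y => φ (linFun a y)) x = a i * deriv φ (linFun a x) := by
  rw [partialDeriv_comp i (hφ _) ((contDiff_linFun a).differentiable (by simp) x),
    partialDeriv_linFun, mul_comm]

lemma partialDeriv_partialDeriv_comp_linFun {φ : ℝ → ℝ} (hφ : ContDiff ℝ ∞ φ) (a : ι → ℝ)
    (i j : ι) (x : ι → ℝ) :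
    partialDeriv i (partialDeriv j fun y => φ (linFun a y)) x
      = deriv (deriv φ) (linFun a x) * (a i * a j) := by
  have hφ' : Differentiable ℝ (deriv φ) :=
    (contDiff_infty_iff_deriv.1 hφ).2.differentiable (by simp)
  rw [funext (partialDeriv_comp_linFun (hφ.differentiable (by simp)) a j),
    partialDeriv_const_mul (F := fun y => deriv φ (linFun a y)) i (a j)
      (hφ'.comp ((contDiff_linFun a).differentiable (by simp)) x),
    partialDeriv_comp_linFun hφ']
  ring

end LinFun

section Projections

variable {ι κ : Type*}

lemma contDiff_baseProj [Fintype ι] [Fintype κ] :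
    ContDiff ℝ ∞ (baseProj : (ι ⊕ κ → ℝ) → ι → ℝ) :=
  contDiff_pi.2 fun i => contDiff_apply ℝ ℝ (Sum.inl i)

lemma contDiff_fiberProj [Fintype ι] [Fintype κ] :
    ContDiff ℝ ∞ (fiberProj : (ι ⊕ κ → ℝ) → κ → ℝ) :=
  contDiff_pi.2 fun j => contDiff_apply ℝ ℝ (Sum.inr j)

lemma hasFDerivAt_baseProj [Finite ι] [Finite κ] (p : ι ⊕ κ → ℝ) :
    HasFDerivAt (baseProj : (ι ⊕ κ → ℝ) → ι → ℝ)
      (ContinuousLinearMap.pi fun i =>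
        ContinuousLinearMap.proj (R := ℝ) (φ := fun _ : ι ⊕ κ => ℝ) (Sum.inl i)) p := by
  cases nonempty_fintype ι
  cases nonempty_fintype κ
  exact hasFDerivAt_pi.2 fun i => hasFDerivAt_apply (Sum.inl i) p

lemma hasFDerivAt_fiberProj [Finite ι] [Finite κ] (p : ι ⊕ κ → ℝ) :
    HasFDerivAt (fiberProj : (ι ⊕ κ → ℝ) → κ → ℝ)
      (ContinuousLinearMap.pi fun j =>
        ContinuousLinearMap.proj (R := ℝ) (φ := fun _ : ι ⊕ κ => ℝ) (Sum.inr j)) p := by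
  cases nonempty_fintype ι
  cases nonempty_fintype κ
  exact hasFDerivAt_pi.2 fun j => hasFDerivAt_apply (Sum.inr j) p

lemma fiberProj_surjective : Function.Surjective (fiberProj : (ι ⊕ κ → ℝ) → κ → ℝ) :=
  fun y => ⟨Sum.elim 0 y, rfl⟩

variable [DecidableEq ι] [DecidableEq κ] [Finite ι] [Finite κ]

lemma partialDeriv_inl_comp_baseProj {F : (ι → ℝ) → ℝ} (hF : Differentiable ℝ F) (i : ι)
    (p : ι ⊕ κ → ℝ) :
    partialDeriv (Sum.inl i) (fun q : ι ⊕ κ → ℝ => F (baseProj q)) p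
      = partialDeriv i F (baseProj p) := by
  cases nonempty_fintype ι
  cases nonempty_fintype κ
  change fderiv ℝ (F ∘ baseProj) p _ = _
  rw [((hF _).hasFDerivAt.comp p (hasFDerivAt_baseProj p)).fderiv, partialDeriv,
    ContinuousLinearMap.comp_apply]
  congr 1
  ext k
  simp [Pi.single_apply]

lemma partialDeriv_inr_comp_baseProj {F : (ι → ℝ) → ℝ} (hF : Differentiable ℝ F) (j : κ)
    (p : ι ⊕ κ → ℝ) :
    partialDeriv (Sum.inr j) (fun q : ι ⊕ κ → ℝ => F (baseProj q)) p = 0 := by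
  cases nonempty_fintype ι
  cases nonempty_fintype κ
  change fderiv ℝ (F ∘ baseProj) p _ = _
  rw [((hF _).hasFDerivAt.comp p (hasFDerivAt_baseProj p)).fderiv,
    ContinuousLinearMap.comp_apply]
  convert map_zero (fderiv ℝ F (baseProj p))
  ext k
  simp

lemma partialDeriv_inr_comp_fiberProj {F : (κ → ℝ) → ℝ} (hF : Differentiable ℝ F) (j : κ)
    (p : ι ⊕ κ → ℝ) :
    partialDeriv (Sum.inr j) (fun q : ι ⊕ κ → ℝ => F (fiberProj q)) p
      = partialDeriv j F (fiberProj p) := by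
  cases nonempty_fintype ι
  cases nonempty_fintype κ
  change fderiv ℝ (F ∘ fiberProj) p _ = _
  rw [((hF _).hasFDerivAt.comp p (hasFDerivAt_fiberProj p)).fderiv, partialDeriv,
    ContinuousLinearMap.comp_apply]
  congr 1
  ext k
  simp [Pi.single_apply]

lemma partialDeriv_inl_comp_fiberProj {F : (κ → ℝ) → ℝ} (hF : Differentiable ℝ F) (i : ι)
    (p : ι ⊕ κ → ℝ) :
    partialDeriv (Sum.inl i) (fun q : ι ⊕ κ → ℝ => F (fiberProj q)) p = 0 := by
  cases nonempty_fintype ι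
  cases nonempty_fintype κ
  change fderiv ℝ (F ∘ fiberProj) p _ = _
  rw [((hF _).hasFDerivAt.comp p (hasFDerivAt_fiberProj p)).fderiv,
    ContinuousLinearMap.comp_apply]
  convert map_zero (fderiv ℝ F (fiberProj p))
  ext k
  simp

lemma partialDeriv_inl_baseProj_mul_fiberProj {F : (ι → ℝ) → ℝ} {G : (κ → ℝ) → ℝ}
    (hF : Differentiable ℝ F) (hG : Differentiable ℝ G) (i : ι) (p : ι ⊕ κ → ℝ) :
    partialDeriv (Sum.inl i) (fun q : ι ⊕ κ → ℝ => F (baseProj q) * G (fiberProj q)) p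
      = partialDeriv i F (baseProj p) * G (fiberProj p) := by
  cases nonempty_fintype ι
  cases nonempty_fintype κ
  have hF' : Differentiable ℝ fun q : ι ⊕ κ → ℝ => F (baseProj q) :=
    hF.comp (contDiff_baseProj.differentiable (by simp))
  have hG' : Differentiable ℝ fun q : ι ⊕ κ → ℝ => G (fiberProj q) :=
    hG.comp (contDiff_fiberProj.differentiable (by simp))
  rw [partialDeriv_mul _ (hF' p) (hG' p),
    partialDeriv_inl_comp_baseProj hF, partialDeriv_inl_comp_fiberProj hG, mul_zero, add_zero]

lemma partialDeriv_inr_baseProj_mul_fiberProj {F : (ι → ℝ) → ℝ} {G : (κ → ℝ) → ℝ}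
    (hF : Differentiable ℝ F) (hG : Differentiable ℝ G) (j : κ) (p : ι ⊕ κ → ℝ) :
    partialDeriv (Sum.inr j) (fun q : ι ⊕ κ → ℝ => F (baseProj q) * G (fiberProj q)) p
      = F (baseProj p) * partialDeriv j G (fiberProj p) := by
  cases nonempty_fintype ι
  cases nonempty_fintype κ
  have hF' : Differentiable ℝ fun q : ι ⊕ κ → ℝ => F (baseProj q) :=
    hF.comp (contDiff_baseProj.differentiable (by simp))
  have hG' : Differentiable ℝ fun q : ι ⊕ κ → ℝ => G (fiberProj q) :=
    hG.comp (contDiff_fiberProj.differentiable (by simp))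
  rw [partialDeriv_mul _ (hF' p) (hG' p),
    partialDeriv_inr_comp_baseProj hF, partialDeriv_inr_comp_fiberProj hG, zero_mul, zero_add]

end Projections

section MatrixSmoothness

variable {E ι : Type*} [NormedAddCommGroup E] [NormedSpace ℝ E] [Fintype ι] [DecidableEq ι]
  {n : WithTop ℕ∞} {A : E → Matrix ι ι ℝ}

lemma contDiff_det (hA : ∀ i j, ContDiff ℝ n fun x => A x i j) :
    ContDiff ℝ n fun x => (A x).det := by
  simp only [Matrix.det_apply]
  exact ContDiff.sum fun σ _ => (contDiff_prod fun i _ => hA (σ i) i).const_smul _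

lemma contDiff_adjugate (hA : ∀ i j, ContDiff ℝ n fun x => A x i j) (i j : ι) :
    ContDiff ℝ n fun x => (A x).adjugate i j := by
  simp only [Matrix.adjugate_apply]
  refine contDiff_det fun k l => ?_
  by_cases hk : k = j
  · subst hk
    simpa only [Matrix.updateRow_self] using contDiff_const
  · simpa only [Matrix.updateRow_ne hk] using hA k l

lemma contDiff_inv (hA : ∀ i j, ContDiff ℝ n fun x => A x i j) (hdet : ∀ x, IsUnit (A x).det)
    (i j : ι) : ContDiff ℝ n fun x => (A x)⁻¹ i j := by
  simp only [Matrix.inv_def, Ring.inverse_eq_inv', Matrix.smul_apply, smul_eq_mul]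
  exact ((contDiff_det hA).inv fun x => (hdet x).ne_zero).mul (contDiff_adjugate hA i j)

end MatrixSmoothness

section SemiRiemannian

variable {ι : Type*} [Fintype ι] [DecidableEq ι] {g : (ι → ℝ) → Matrix ι ι ℝ}
  {F : (ι → ℝ) → ℝ}

/-- The trace `∑ᵢ Γⁱᵢₖ` of the Christoffel symbols, which is `∂ₖ log √|det g|`. It carries the
first-order term of the divergence. -/
def christoffelTrace (g : (ι → ℝ) → Matrix ι ι ℝ) (k : ι) (x : ι → ℝ) : ℝ :=
  ∑ i, christoffel g i i k x

/-- The divergence `∑ᵢ ∇ᵢXⁱ` of a vector field, in the Levi-Civita connection of `g`. -/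
def divergence (g : (ι → ℝ) → Matrix ι ι ℝ) (X : (ι → ℝ) → ι → ℝ) (x : ι → ℝ) : ℝ :=
  ∑ i, partialDeriv i (fun y => X y i) x + ∑ k, christoffelTrace g k x * X x k

namespace IsSemiRiemannianMetric

lemma differentiable (hg : IsSemiRiemannianMetric g) (i j : ι) :
    Differentiable ℝ fun x => g x i j :=
  (hg.smooth i j).differentiable (by simp)

lemma contDiff_inv (hg : IsSemiRiemannianMetric g) (i j : ι) :
    ContDiff ℝ ∞ fun x => (g x)⁻¹ i j :=
  GRHS.contDiff_inv hg.smooth hg.nondegenerate i j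

lemma inv_apply_comm (hg : IsSemiRiemannianMetric g) (x : ι → ℝ) (i j : ι) :
    (g x)⁻¹ i j = (g x)⁻¹ j i :=
  (hg.symm x).inv.apply j i

lemma contDiff_christoffel (hg : IsSemiRiemannianMetric g) (k i j : ι) :
    ContDiff ℝ ∞ (christoffel g k i j) :=
  contDiff_const.mul <| ContDiff.sum fun l _ => (hg.contDiff_inv k l).mul <|
    ((contDiff_partialDeriv (hg.smooth j l) i).add (contDiff_partialDeriv (hg.smooth i l) j)).sub
      (contDiff_partialDeriv (hg.smooth i j) l)

lemma contDiff_christoffelTrace (hg : IsSemiRiemannianMetric g) (k : ι) :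
    ContDiff ℝ ∞ (christoffelTrace g k) :=
  ContDiff.sum fun i _ => hg.contDiff_christoffel i i k

lemma contDiff_grad (hg : IsSemiRiemannianMetric g) (hF : ContDiff ℝ ∞ F) (i : ι) :
    ContDiff ℝ ∞ fun x => grad g F x i :=
  ContDiff.sum fun j _ => (hg.contDiff_inv i j).mul (contDiff_partialDeriv hF j)

lemma christoffel_comm (hg : IsSemiRiemannianMetric g) (k i j : ι) :
    christoffel g k i j = christoffel g k j i := by
  funext x
  have hsymm : (fun y => g y i j) = fun y => g y j i := funext fun y => (hg.symm y).apply j i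
  simp only [christoffel, hsymm, add_comm (partialDeriv i _ x)]

lemma hess_comm (hg : IsSemiRiemannianMetric g) (hF : ContDiff ℝ ∞ F) (i j : ι) (x : ι → ℝ) :
    hess g F i j x = hess g F j i x := by
  simp only [hess, partialDeriv_comm hF i j, hg.christoffel_comm _ i j]

lemma sum_mul_grad (hg : IsSemiRiemannianMetric g) (F : (ι → ℝ) → ℝ) (i : ι) (x : ι → ℝ) :
    ∑ j, g x i j * grad g F x j = partialDeriv i F x := by
  have hinv : (g x).mulVec ((g x)⁻¹.mulVec fun j => partialDeriv j F x)
      = fun j => partialDeriv j F x := by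
    rw [Matrix.mulVec_mulVec, Matrix.mul_nonsing_inv _ (hg.nondegenerate x), Matrix.one_mulVec]
  exact congrFun hinv i

lemma metricInner_grad_right (hg : IsSemiRiemannianMetric g) (F : (ι → ℝ) → ℝ) (x X : ι → ℝ) :
    metricInner g x X (grad g F x) = ∑ i, X i * partialDeriv i F x := by
  simp only [metricInner, ← hg.sum_mul_grad F, Finset.mul_sum]
  exact Finset.sum_congr rfl fun i _ => Finset.sum_congr rfl fun j _ => by ring

lemma sum_christoffel_mul_partialDeriv (hg : IsSemiRiemannianMetric g) (F : (ι → ℝ) → ℝ)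
    (i j : ι) (x : ι → ℝ) :
    ∑ k, christoffel g k i j x * partialDeriv k F x
      = (1 / 2 : ℝ) * ∑ l, grad g F x l *
        (partialDeriv i (fun y => g y j l) x + partialDeriv j (fun y => g y i l) x
          - partialDeriv l (fun y => g y i j) x) := by
  simp only [christoffel, grad, mul_assoc, ← Finset.mul_sum, Finset.sum_mul]
  rw [Finset.sum_comm]
  congr 1
  refine Finset.sum_congr rfl fun l _ => Finset.sum_congr rfl fun k _ => ?_
  rw [hg.inv_apply_comm x k l]
  ring

/-- The derivatives of the metric enter the Hessian through differentiation of
`∂ⱼF = ∑ₖ gⱼₖ (∇F)ᵏ`. -/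
lemma hess_eq_sum_partialDeriv_grad (hg : IsSemiRiemannianMetric g) (hF : ContDiff ℝ ∞ F)
    (i j : ι) (x : ι → ℝ) :
    hess g F i j x
      = ∑ k, g x j k * partialDeriv i (fun y => grad g F y k) x
        + (1 / 2 : ℝ) * ∑ k, grad g F x k *
          (partialDeriv i (fun y => g y j k) x - partialDeriv j (fun y => g y i k) x
            + partialDeriv k (fun y => g y i j) x) := by
  have hgrad (k : ι) : Differentiable ℝ fun y => grad g F y k :=
    (hg.contDiff_grad hF k).differentiable (by simp)
  have hsecond : partialDeriv i (partialDeriv j F) x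
      = ∑ k, (partialDeriv i (fun y => g y j k) x * grad g F x k
        + g x j k * partialDeriv i (fun y => grad g F y k) x) := by
    rw [← funext (hg.sum_mul_grad F j),
      partialDeriv_sum i fun k _ => (hg.differentiable j k x).fun_mul (hgrad k x)]
    exact Finset.sum_congr rfl fun k _ => partialDeriv_mul i (hg.differentiable j k x) (hgrad k x)
  rw [hess, hsecond, hg.sum_christoffel_mul_partialDeriv]
  simp only [Finset.mul_sum, ← Finset.sum_sub_distrib, ← Finset.sum_add_distrib]
  exact Finset.sum_congr rfl fun k _ => by ring

lemma sum_inv_mul_sub_swap (hg : IsSemiRiemannianMetric g) (x : ι → ℝ) (c : ι → ι → ℝ) :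
    ∑ i, ∑ j, (g x)⁻¹ i j * (c i j - c j i) = 0 := by
  simp only [mul_sub, Finset.sum_sub_distrib]
  rw [sub_eq_zero, Finset.sum_comm]
  exact Finset.sum_congr rfl fun j _ => Finset.sum_congr rfl fun i _ => by
    rw [hg.inv_apply_comm x i j]

lemma christoffelTrace_eq_sum_inv (hg : IsSemiRiemannianMetric g) (k : ι) (x : ι → ℝ) :
    christoffelTrace g k x
      = (1 / 2 : ℝ) * ∑ i, ∑ j, (g x)⁻¹ i j * partialDeriv k (fun y => g y i j) x := by
  have hskew := hg.sum_inv_mul_sub_swap x fun i j => partialDeriv i (fun y => g y k j) x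
  have hsymm (i j : ι) : (fun y => g y i j) = fun y => g y j i :=
    funext fun y => (hg.symm y).apply j i
  rw [← add_zero (∑ i, _), ← hskew]
  simp only [christoffelTrace, christoffel, ← Finset.mul_sum, ← Finset.sum_add_distrib, ← mul_add]
  congr 1
  refine Finset.sum_congr rfl fun i _ => Finset.sum_congr rfl fun j _ => ?_
  rw [hsymm i k]
  ring

theorem divergence_grad (hg : IsSemiRiemannianMetric g) (hF : ContDiff ℝ ∞ F) (x : ι → ℝ) :
    divergence g (grad g F) x = tension g F x := by
  have hdiv (i : ι) : ∑ j, (g x)⁻¹ i j *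
      ∑ k, g x j k * partialDeriv i (fun y => grad g F y k) x
        = partialDeriv i (fun y => grad g F y i) x := by
    have hinv : (g x)⁻¹.mulVec
        ((g x).mulVec fun k => partialDeriv i (fun y => grad g F y k) x)
          = fun k => partialDeriv i (fun y => grad g F y k) x := by
      rw [Matrix.mulVec_mulVec, Matrix.nonsing_inv_mul _ (hg.nondegenerate x), Matrix.one_mulVec]
    exact congrFun hinv i
  have hskew := hg.sum_inv_mul_sub_swap x fun i j =>
    (1 / 2 : ℝ) * ∑ k, grad g F x k * partialDeriv i (fun y => g y j k) x
  have htrace : ∑ k, christoffelTrace g k x * grad g F x k = ∑ i, ∑ j, (g x)⁻¹ i j *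
      ((1 / 2 : ℝ) * ∑ k, grad g F x k * partialDeriv k (fun y => g y i j) x) := by
    simp only [hg.christoffelTrace_eq_sum_inv, Finset.mul_sum, Finset.sum_mul]
    rw [Finset.sum_comm]
    refine Finset.sum_congr rfl fun i _ => ?_
    rw [Finset.sum_comm]
    exact Finset.sum_congr rfl fun j _ => Finset.sum_congr rfl fun k _ => by ring
  rw [divergence, tension, htrace, ← add_zero (_ + _), ← hskew]
  simp only [← hdiv, ← Finset.sum_add_distrib, ← mul_add, hg.hess_eq_sum_partialDeriv_grad hF]
  refine Finset.sum_congr rfl fun i _ => Finset.sum_congr rfl fun j _ => ?_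
  simp only [mul_add, mul_sub, Finset.sum_add_distrib, Finset.sum_sub_distrib]
  ring

lemma ricci_eq_sum_christoffel (hg : IsSemiRiemannianMetric g) (j k : ι) (x : ι → ℝ) :
    ricci g j k x
      = ∑ i, partialDeriv i (christoffel g i j k) x - partialDeriv j (christoffelTrace g k) x
        + ∑ p, christoffelTrace g p x * christoffel g p j k x
        - ∑ i, ∑ p, christoffel g i j p x * christoffel g p i k x := by
  have htrace : partialDeriv j (christoffelTrace g k) x
      = ∑ i, partialDeriv j (christoffel g i i k) x :=
    partialDeriv_sum j fun i _ => (hg.contDiff_christoffel i i k).differentiable (by simp) x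
  have hcontract : ∑ p, christoffelTrace g p x * christoffel g p j k x
      = ∑ i, ∑ p, christoffel g i i p x * christoffel g p j k x := by
    simp only [christoffelTrace, Finset.sum_mul]
    exact Finset.sum_comm
  simp only [ricci, riemann, htrace, hcontract, Finset.sum_add_distrib, Finset.sum_sub_distrib]
  ring

lemma ricci_sub_ricci_swap (hg : IsSemiRiemannianMetric g) (j k : ι) (x : ι → ℝ) :
    ricci g j k x - ricci g k j x
      = partialDeriv k (christoffelTrace g j) x - partialDeriv j (christoffelTrace g k) x := by
  have hquad : ∑ i, ∑ p, christoffel g i j p x * christoffel g p i k x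
      = ∑ i, ∑ p, christoffel g i k p x * christoffel g p i j x := by
    rw [Finset.sum_comm]
    refine Finset.sum_congr rfl fun i _ => Finset.sum_congr rfl fun p _ => ?_
    rw [hg.christoffel_comm i p k, hg.christoffel_comm p j i, mul_comm]
  rw [hg.ricci_eq_sum_christoffel, hg.ricci_eq_sum_christoffel, hquad]
  simp only [hg.christoffel_comm _ j k]
  ring

end IsSemiRiemannianMetric

end SemiRiemannian

section WarpedProduct

variable {ι κ : Type*} [DecidableEq ι] [DecidableEq κ]
  {gB : (ι → ℝ) → Matrix ι ι ℝ} {f : (ι → ℝ) → ℝ} {gF : (κ → ℝ) → Matrix κ κ ℝ}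

lemma partialDeriv_warpedMetric_inl_inr (A : ι ⊕ κ) (i : ι) (b : κ) (p : ι ⊕ κ → ℝ) :
    partialDeriv A (fun q => warpedMetric gB f gF q (.inl i) (.inr b)) p = 0 :=
  partialDeriv_const A 0 p

lemma partialDeriv_warpedMetric_inr_inl (A : ι ⊕ κ) (a : κ) (j : ι) (p : ι ⊕ κ → ℝ) :
    partialDeriv A (fun q => warpedMetric gB f gF q (.inr a) (.inl j)) p = 0 :=
  partialDeriv_const A 0 p

lemma partialDeriv_inl_warpedMetric_inl_inl [Fintype ι] [Finite κ]
    (hgB : IsSemiRiemannianMetric gB) (k i j : ι) (p : ι ⊕ κ → ℝ) :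
    partialDeriv (.inl k) (fun q => warpedMetric gB f gF q (.inl i) (.inl j)) p
      = partialDeriv k (fun x => gB x i j) (baseProj p) :=
  partialDeriv_inl_comp_baseProj (hgB.differentiable i j) k p

lemma partialDeriv_inr_warpedMetric_inl_inl [Fintype ι] [Finite κ]
    (hgB : IsSemiRiemannianMetric gB) (c : κ) (i j : ι) (p : ι ⊕ κ → ℝ) :
    partialDeriv (.inr c) (fun q => warpedMetric gB f gF q (.inl i) (.inl j)) p = 0 :=
  partialDeriv_inr_comp_baseProj (hgB.differentiable i j) c p

lemma partialDeriv_inl_warpedMetric_inr_inr [Finite ι] [Fintype κ]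
    (hf : Differentiable ℝ f) (hgF : IsSemiRiemannianMetric gF) (k : ι) (a b : κ) (p : ι ⊕ κ → ℝ) :
    partialDeriv (.inl k) (fun q => warpedMetric gB f gF q (.inr a) (.inr b)) p
      = 2 * f (baseProj p) * partialDeriv k f (baseProj p) * gF (fiberProj p) a b := by
  cases nonempty_fintype ι
  have hsq := partialDeriv_comp (φ := fun s => s ^ 2) k (by fun_prop) (hf (baseProj p))
  refine (partialDeriv_inl_baseProj_mul_fiberProj (hf.fun_pow 2) (hgF.differentiable a b)
    k p).trans ?_
  simp [hsq]

lemma partialDeriv_inr_warpedMetric_inr_inr [Finite ι] [Fintype κ]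
    (hf : Differentiable ℝ f) (hgF : IsSemiRiemannianMetric gF) (c a b : κ) (p : ι ⊕ κ → ℝ) :
    partialDeriv (.inr c) (fun q => warpedMetric gB f gF q (.inr a) (.inr b)) p
      = f (baseProj p) ^ 2 * partialDeriv c (fun y => gF y a b) (fiberProj p) := by
  cases nonempty_fintype ι
  exact partialDeriv_inr_baseProj_mul_fiberProj (hf.fun_pow 2) (hgF.differentiable a b) c p

variable [Fintype ι] [Fintype κ]

lemma warpedMetric_inv (hgB : IsSemiRiemannianMetric gB) (hf0 : ∀ x, f x ≠ 0)
    (hgF : IsSemiRiemannianMetric gF) (p : ι ⊕ κ → ℝ) :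
    (warpedMetric gB f gF p)⁻¹
      = Matrix.fromBlocks (gB (baseProj p))⁻¹ 0 0
        ((f (baseProj p) ^ 2)⁻¹ • (gF (fiberProj p))⁻¹) := by
  refine Matrix.inv_eq_right_inv ?_
  have hf : f (baseProj p) ^ 2 ≠ 0 := pow_ne_zero 2 (hf0 _)
  rw [warpedMetric, Matrix.fromBlocks_multiply]
  simp [Matrix.mul_nonsing_inv _ (hgB.nondegenerate _),
    Matrix.mul_nonsing_inv _ (hgF.nondegenerate _), hf]

lemma IsSemiRiemannianMetric.warpedMetric (hgB : IsSemiRiemannianMetric gB)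
    (hf : ContDiff ℝ ∞ f) (hf0 : ∀ x, f x ≠ 0) (hgF : IsSemiRiemannianMetric gF) :
    IsSemiRiemannianMetric (warpedMetric gB f gF) where
  smooth
    | .inl i, .inl j => (hgB.smooth i j).comp contDiff_baseProj
    | .inl _, .inr _ => contDiff_const
    | .inr _, .inl _ => contDiff_const
    | .inr a, .inr b => ((hf.comp contDiff_baseProj).pow 2).mul
        ((hgF.smooth a b).comp contDiff_fiberProj)
  symm p := (hgB.symm _).fromBlocks (Matrix.transpose_zero ..) ((hgF.symm _).smul _)
  nondegenerate p := by
    rw [GRHS.warpedMetric, Matrix.det_fromBlocks_zero₂₁, Matrix.det_smul]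
    exact (hgB.nondegenerate _).mul
      ((((isUnit_iff_ne_zero.2 (hf0 _)).pow 2).pow _).mul (hgF.nondegenerate _))

section

variable (hgB : IsSemiRiemannianMetric gB) (hf0 : ∀ x, f x ≠ 0)
  (hgF : IsSemiRiemannianMetric gF)

include hgB hf0 hgF

lemma christoffel_warpedMetric_inl_inl_inl (k i j : ι) :
    christoffel (warpedMetric gB f gF) (.inl k) (.inl i) (.inl j)
      = fun p => christoffel gB k i j (baseProj p) := by
  funext p
  simp [christoffel, Fintype.sum_sum_type, warpedMetric_inv hgB hf0 hgF,
    partialDeriv_inl_warpedMetric_inl_inl hgB]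

lemma christoffel_warpedMetric_inr_inl_inl (c : κ) (i j : ι) :
    christoffel (warpedMetric gB f gF) (.inr c) (.inl i) (.inl j) = fun _ => 0 := by
  funext p
  simp [christoffel, Fintype.sum_sum_type, warpedMetric_inv hgB hf0 hgF,
    partialDeriv_inr_warpedMetric_inl_inl hgB, partialDeriv_warpedMetric_inl_inr]

lemma christoffel_warpedMetric_inl_inl_inr (k i : ι) (b : κ) :
    christoffel (warpedMetric gB f gF) (.inl k) (.inl i) (.inr b) = fun _ => 0 := by
  funext p
  simp [christoffel, Fintype.sum_sum_type, warpedMetric_inv hgB hf0 hgF,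
    partialDeriv_inr_warpedMetric_inl_inl hgB, partialDeriv_warpedMetric_inl_inr,
    partialDeriv_warpedMetric_inr_inl]

end

variable (hgB : IsSemiRiemannianMetric gB) (hf : ContDiff ℝ ∞ f) (hf0 : ∀ x, f x ≠ 0)
  (hgF : IsSemiRiemannianMetric gF)

include hgB hf hf0 hgF

lemma christoffel_warpedMetric_inl_inr_inr (k : ι) (a b : κ) :
    christoffel (warpedMetric gB f gF) (.inl k) (.inr a) (.inr b)
      = fun p => -(f (baseProj p) * grad gB f (baseProj p) k) * gF (fiberProj p) a b := by
  funext p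
  have hd : Differentiable ℝ f := hf.differentiable (by simp)
  simp only [christoffel, Fintype.sum_sum_type, warpedMetric_inv hgB hf0 hgF,
    Matrix.fromBlocks_apply₁₁, Matrix.fromBlocks_apply₁₂, Matrix.zero_apply, zero_mul,
    partialDeriv_warpedMetric_inr_inl, partialDeriv_inl_warpedMetric_inr_inr hd hgF, grad,
    Finset.sum_const_zero, add_zero, zero_sub, Finset.mul_sum, neg_mul, Finset.sum_mul,
    ← Finset.sum_neg_distrib]
  exact Finset.sum_congr rfl fun l _ => by ring

lemma christoffel_warpedMetric_inr_inl_inr (i : ι) (b c : κ) :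
    christoffel (warpedMetric gB f gF) (.inr c) (.inl i) (.inr b)
      = fun p => (1 : Matrix κ κ ℝ) c b
        * (partialDeriv i f (baseProj p) / f (baseProj p)) := by
  funext p
  have hd : Differentiable ℝ f := hf.differentiable (by simp)
  have hfp := hf0 (baseProj p)
  have hinv : ∑ d, (gF (fiberProj p))⁻¹ c d * gF (fiberProj p) b d = (1 : Matrix κ κ ℝ) c b := by
    rw [← Matrix.nonsing_inv_mul _ (hgF.nondegenerate (fiberProj p)), Matrix.mul_apply]
    simp only [(hgF.symm (fiberProj p)).apply]
  simp only [christoffel, Fintype.sum_sum_type, warpedMetric_inv hgB hf0 hgF,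
    Matrix.fromBlocks_apply₂₁, Matrix.fromBlocks_apply₂₂, Matrix.zero_apply, zero_mul,
    partialDeriv_warpedMetric_inl_inr, partialDeriv_inl_warpedMetric_inr_inr hd hgF,
    Finset.sum_const_zero, zero_add, add_zero, sub_zero, ← hinv, Finset.mul_sum, Finset.sum_mul,
    Matrix.smul_apply, smul_eq_mul]
  refine Finset.sum_congr rfl fun d _ => ?_
  field_simp

lemma christoffel_warpedMetric_inr_inr_inr (a b c : κ) :
    christoffel (warpedMetric gB f gF) (.inr c) (.inr a) (.inr b)
      = fun p => christoffel gF c a b (fiberProj p) := by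
  funext p
  have hd : Differentiable ℝ f := hf.differentiable (by simp)
  have hfp := hf0 (baseProj p)
  simp only [christoffel, Fintype.sum_sum_type, warpedMetric_inv hgB hf0 hgF,
    Matrix.fromBlocks_apply₂₁, Matrix.fromBlocks_apply₂₂, Matrix.zero_apply, zero_mul,
    partialDeriv_inr_warpedMetric_inr_inr hd hgF, Finset.sum_const_zero, zero_add,
    Matrix.smul_apply, smul_eq_mul]
  congr 1
  refine Finset.sum_congr rfl fun d _ => ?_
  field_simp

lemma christoffel_warpedMetric_inl_inr_inl (k i : ι) (b : κ) :
    christoffel (warpedMetric gB f gF) (.inl k) (.inr b) (.inl i) = fun _ => 0 := by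
  rw [(hgB.warpedMetric hf hf0 hgF).christoffel_comm,
    christoffel_warpedMetric_inl_inl_inr hgB hf0 hgF]

lemma christoffel_warpedMetric_inr_inr_inl (i : ι) (b c : κ) :
    christoffel (warpedMetric gB f gF) (.inr c) (.inr b) (.inl i)
      = fun p => (1 : Matrix κ κ ℝ) c b
        * (partialDeriv i f (baseProj p) / f (baseProj p)) := by
  rw [(hgB.warpedMetric hf hf0 hgF).christoffel_comm,
    christoffel_warpedMetric_inr_inl_inr hgB hf hf0 hgF]

lemma christoffelTrace_warpedMetric_inl (k : ι) :
    christoffelTrace (warpedMetric gB f gF) (.inl k)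
      = fun p => christoffelTrace gB k (baseProj p)
        + Fintype.card κ * (partialDeriv k f (baseProj p) / f (baseProj p)) := by
  funext p
  simp [christoffelTrace, Fintype.sum_sum_type,
    christoffel_warpedMetric_inl_inl_inl hgB hf0 hgF,
    christoffel_warpedMetric_inr_inr_inl hgB hf hf0 hgF]

lemma christoffelTrace_warpedMetric_inr (c : κ) :
    christoffelTrace (warpedMetric gB f gF) (.inr c)
      = fun p => christoffelTrace gF c (fiberProj p) := by
  funext p
  simp [christoffelTrace, Fintype.sum_sum_type,
    christoffel_warpedMetric_inl_inl_inr hgB hf0 hgF,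
    christoffel_warpedMetric_inr_inr_inr hgB hf hf0 hgF]

lemma partialDeriv_christoffelTrace_warpedMetric_inl (j k : ι) (p : ι ⊕ κ → ℝ) :
    partialDeriv (.inl j) (christoffelTrace (warpedMetric gB f gF) (.inl k)) p
      = partialDeriv j (christoffelTrace gB k) (baseProj p) + Fintype.card κ *
        (partialDeriv j (partialDeriv k f) (baseProj p) / f (baseProj p)
          - partialDeriv k f (baseProj p) * partialDeriv j f (baseProj p)
            / f (baseProj p) ^ 2) := by
  have hT : Differentiable ℝ (christoffelTrace gB k) :=
    (hgB.contDiff_christoffelTrace k).differentiable (by simp)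
  have hd : Differentiable ℝ f := hf.differentiable (by simp)
  have hdd : Differentiable ℝ (partialDeriv k f) :=
    (contDiff_partialDeriv hf k).differentiable (by simp)
  have hlog : Differentiable ℝ fun x => partialDeriv k f x / f x :=
    ((contDiff_partialDeriv hf k).div hf hf0).differentiable (by simp)
  rw [christoffelTrace_warpedMetric_inl hgB hf hf0 hgF,
    partialDeriv_inl_comp_baseProj
      (F := fun x => christoffelTrace gB k x + Fintype.card κ * (partialDeriv k f x / f x))
      (hT.fun_add (hlog.const_mul _)),
    partialDeriv_add j (hT _) (hlog.const_mul _ _), partialDeriv_const_mul j _ (hlog _),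
    partialDeriv_div j (hdd _) (hd _) (hf0 _)]

theorem ricci_warpedMetric_inl_inl (j k : ι) (p : ι ⊕ κ → ℝ) :
    ricci (warpedMetric gB f gF) (.inl j) (.inl k) p
      = ricci gB j k (baseProj p)
        - Fintype.card κ / f (baseProj p) * hess gB f j k (baseProj p) := by
  have hfp := hf0 (baseProj p)
  have hdiv (i : ι) : partialDeriv (.inl i) (fun q : ι ⊕ κ → ℝ =>
      christoffel gB i j k (baseProj q)) p = partialDeriv i (christoffel gB i j k) (baseProj p) :=
    partialDeriv_inl_comp_baseProj ((hgB.contDiff_christoffel i j k).differentiable (by simp)) i p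
  rw [(hgB.warpedMetric hf hf0 hgF).ricci_eq_sum_christoffel, hgB.ricci_eq_sum_christoffel, hess,
    partialDeriv_christoffelTrace_warpedMetric_inl hgB hf hf0 hgF]
  simp only [Fintype.sum_sum_type, christoffel_warpedMetric_inl_inl_inl hgB hf0 hgF,
    christoffel_warpedMetric_inr_inl_inl hgB hf0 hgF,
    christoffel_warpedMetric_inl_inl_inr hgB hf0 hgF,
    christoffel_warpedMetric_inr_inl_inr hgB hf hf0 hgF,
    christoffel_warpedMetric_inr_inr_inl hgB hf hf0 hgF,
    christoffelTrace_warpedMetric_inl hgB hf hf0 hgF,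
    partialDeriv_const, hdiv, Finset.sum_const_zero, mul_zero, zero_mul, add_zero, zero_add,
    Matrix.one_apply, ite_mul, mul_ite, one_mul, Finset.sum_ite_eq', Finset.sum_const,
    Finset.mem_univ, if_true, Finset.card_univ, nsmul_eq_mul, add_mul,
    Finset.sum_add_distrib, mul_assoc, ← Finset.mul_sum]
  simp only [div_mul_eq_mul_div, ← Finset.sum_div,
    mul_comm (partialDeriv _ f _) (christoffel _ _ _ _ _)]
  field_simp
  ring

lemma ricci_warpedMetric_inl_inr (j : ι) (b : κ) (p : ι ⊕ κ → ℝ) :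
    ricci (warpedMetric gB f gF) (.inl j) (.inr b) p = 0 := by
  have hlog : Differentiable ℝ fun x => partialDeriv j f x / f x :=
    ((contDiff_partialDeriv hf j).div hf hf0).differentiable (by simp)
  have hdiv (c : κ) : partialDeriv (.inr c) (fun q : ι ⊕ κ → ℝ =>
      (1 : Matrix κ κ ℝ) c b * (partialDeriv j f (baseProj q) / f (baseProj q))) p = 0 :=
    partialDeriv_inr_comp_baseProj
      (F := fun x => (1 : Matrix κ κ ℝ) c b * (partialDeriv j f x / f x)) (hlog.const_mul _) c p
  have htrace : partialDeriv (.inl j)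
      (fun q : ι ⊕ κ → ℝ => christoffelTrace gF b (fiberProj q)) p = 0 :=
    partialDeriv_inl_comp_fiberProj
      ((hgF.contDiff_christoffelTrace b).differentiable (by simp)) j p
  rw [(hgB.warpedMetric hf hf0 hgF).ricci_eq_sum_christoffel]
  simp only [Fintype.sum_sum_type, christoffel_warpedMetric_inr_inl_inl hgB hf0 hgF,
    christoffel_warpedMetric_inl_inl_inr hgB hf0 hgF,
    christoffel_warpedMetric_inr_inl_inr hgB hf hf0 hgF,
    christoffel_warpedMetric_inr_inr_inr hgB hf hf0 hgF,
    christoffelTrace_warpedMetric_inr hgB hf hf0 hgF, partialDeriv_const, hdiv, htrace]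
  simp only [Finset.sum_const_zero, mul_zero, zero_mul, add_zero, zero_add, sub_zero,
    Matrix.one_apply, ite_mul, mul_ite, one_mul, Finset.sum_ite_eq, Finset.sum_ite_eq',
    Finset.mem_univ, if_true, ← Finset.mul_sum, christoffelTrace]
  ring

lemma ricci_warpedMetric_inr_inl (a : κ) (j : ι) (p : ι ⊕ κ → ℝ) :
    ricci (warpedMetric gB f gF) (.inr a) (.inl j) p = 0 := by
  have hlog : Differentiable ℝ fun x =>
      christoffelTrace gB j x + Fintype.card κ * (partialDeriv j f x / f x) :=
    ((hgB.contDiff_christoffelTrace j).add (contDiff_const.mul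
      ((contDiff_partialDeriv hf j).div hf hf0))).differentiable (by simp)
  have hinr : partialDeriv (.inr a) (christoffelTrace (warpedMetric gB f gF) (.inl j)) p = 0 := by
    rw [christoffelTrace_warpedMetric_inl hgB hf hf0 hgF, partialDeriv_inr_comp_baseProj hlog]
  have hinl : partialDeriv (.inl j) (christoffelTrace (warpedMetric gB f gF) (.inr a)) p = 0 := by
    rw [christoffelTrace_warpedMetric_inr hgB hf hf0 hgF, partialDeriv_inl_comp_fiberProj
      ((hgF.contDiff_christoffelTrace a).differentiable (by simp))]
  have hswap := (hgB.warpedMetric hf hf0 hgF).ricci_sub_ricci_swap (.inr a) (.inl j) p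
  rwa [ricci_warpedMetric_inl_inr hgB hf hf0 hgF, hinr, hinl, sub_zero, sub_zero] at hswap

lemma sum_christoffel_mul_christoffel_warpedMetric_inr_inr (a b : κ) (p : ι ⊕ κ → ℝ) :
    ∑ A, ∑ B, christoffel (warpedMetric gB f gF) A (.inr a) B p
        * christoffel (warpedMetric gB f gF) B A (.inr b) p
      = ∑ c, ∑ d, christoffel gF c a d (fiberProj p) * christoffel gF d c b (fiberProj p)
        - 2 * metricInner gB (baseProj p) (grad gB f (baseProj p)) (grad gB f (baseProj p))
          * gF (fiberProj p) a b := by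
  have hfp := hf0 (baseProj p)
  have hcross (c d : κ) (r : ℝ) : ∑ k, -(f (baseProj p) * grad gB f (baseProj p) k) *
      gF (fiberProj p) c d * (r * (partialDeriv k f (baseProj p) / f (baseProj p)))
        = -metricInner gB (baseProj p) (grad gB f (baseProj p)) (grad gB f (baseProj p))
          * gF (fiberProj p) c d * r := by
    rw [hgB.metricInner_grad_right, ← Finset.sum_neg_distrib, Finset.sum_mul, Finset.sum_mul]
    refine Finset.sum_congr rfl fun k _ => ?_
    field_simp
  have hcross' (c d : κ) (r : ℝ) := (Finset.sum_congr rfl fun k _ => mul_comm _ _).trans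
    (hcross c d r)
  simp only [Fintype.sum_sum_type, christoffel_warpedMetric_inl_inr_inr hgB hf hf0 hgF,
    christoffel_warpedMetric_inr_inl_inr hgB hf hf0 hgF,
    christoffel_warpedMetric_inl_inr_inl hgB hf hf0 hgF,
    christoffel_warpedMetric_inr_inr_inl hgB hf hf0 hgF,
    christoffel_warpedMetric_inr_inr_inr hgB hf hf0 hgF, zero_mul, Finset.sum_const_zero, zero_add]
  rw [Finset.sum_comm]
  simp only [Finset.sum_add_distrib, hcross, hcross', Matrix.one_apply, mul_ite, mul_one, mul_zero,
    Finset.sum_ite_eq', Finset.mem_univ, if_true]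
  ring

lemma partialDeriv_inl_christoffel_warpedMetric_inl_inr_inr (l k : ι) (a b : κ) (p : ι ⊕ κ → ℝ) :
    partialDeriv (.inl l) (christoffel (warpedMetric gB f gF) (.inl k) (.inr a) (.inr b)) p
      = -(grad gB f (baseProj p) k * partialDeriv l f (baseProj p)
        + f (baseProj p) * partialDeriv l (fun x => grad gB f x k) (baseProj p))
          * gF (fiberProj p) a b := by
  have hd : Differentiable ℝ f := hf.differentiable (by simp)
  have hgrad : Differentiable ℝ fun x => grad gB f x k :=
    (hgB.contDiff_grad hf k).differentiable (by simp)
  rw [christoffel_warpedMetric_inl_inr_inr hgB hf hf0 hgF,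
    partialDeriv_inl_baseProj_mul_fiberProj (F := fun x => -(f x * grad gB f x k))
      (hd.fun_mul hgrad).fun_neg (hgF.differentiable a b),
    partialDeriv_neg l fun x => f x * grad gB f x k, partialDeriv_mul l (hd _) (hgrad _)]
  ring

theorem ricci_warpedMetric_inr_inr (a b : κ) (p : ι ⊕ κ → ℝ) :
    ricci (warpedMetric gB f gF) (.inr a) (.inr b) p
      = ricci gF a b (fiberProj p)
        - (f (baseProj p) * tension gB f (baseProj p)
          + (Fintype.card κ - 1) *
            metricInner gB (baseProj p) (grad gB f (baseProj p)) (grad gB f (baseProj p)))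
          * gF (fiberProj p) a b := by
  have hfp := hf0 (baseProj p)
  have hdiv_fiber (c : κ) : partialDeriv (.inr c) (fun q : ι ⊕ κ → ℝ =>
      christoffel gF c a b (fiberProj q)) p = partialDeriv c (christoffel gF c a b) (fiberProj p) :=
    partialDeriv_inr_comp_fiberProj ((hgF.contDiff_christoffel c a b).differentiable (by simp)) c p
  have htrace : partialDeriv (.inr a)
      (fun q : ι ⊕ κ → ℝ => christoffelTrace gF b (fiberProj q)) p
        = partialDeriv a (christoffelTrace gF b) (fiberProj p) :=
    partialDeriv_inr_comp_fiberProj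
      ((hgF.contDiff_christoffelTrace b).differentiable (by simp)) a p
  have hcontract (k : ι) : (christoffelTrace gB k (baseProj p) + Fintype.card κ
      * (partialDeriv k f (baseProj p) / f (baseProj p)))
      * (-(f (baseProj p) * grad gB f (baseProj p) k) * gF (fiberProj p) a b)
        = -(f (baseProj p) * (christoffelTrace gB k (baseProj p) * grad gB f (baseProj p) k)
          + Fintype.card κ * (grad gB f (baseProj p) k * partialDeriv k f (baseProj p)))
            * gF (fiberProj p) a b := by
    field_simp
  rw [(hgB.warpedMetric hf hf0 hgF).ricci_eq_sum_christoffel, hgF.ricci_eq_sum_christoffel,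
    sum_christoffel_mul_christoffel_warpedMetric_inr_inr hgB hf hf0 hgF,
    hgB.metricInner_grad_right, ← hgB.divergence_grad hf, divergence]
  simp only [Fintype.sum_sum_type,
    partialDeriv_inl_christoffel_warpedMetric_inl_inr_inr hgB hf hf0 hgF]
  simp only [christoffel_warpedMetric_inl_inr_inr hgB hf hf0 hgF,
    christoffel_warpedMetric_inr_inr_inr hgB hf hf0 hgF,
    christoffelTrace_warpedMetric_inl hgB hf hf0 hgF,
    christoffelTrace_warpedMetric_inr hgB hf hf0 hgF, hdiv_fiber, htrace, hcontract]
  simp only [← Finset.sum_mul, Finset.sum_neg_distrib, Finset.sum_add_distrib, ← Finset.mul_sum]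
  ring

section Functions

variable {H : (ι → ℝ) → ℝ} {U : (κ → ℝ) → ℝ}

omit hf in
lemma hess_comp_baseProj_inl_inl (hH : ContDiff ℝ ∞ H) (i j : ι) (p : ι ⊕ κ → ℝ) :
    hess (warpedMetric gB f gF) (fun q => H (baseProj q)) (.inl i) (.inl j) p
      = hess gB H i j (baseProj p) := by
  have hd : Differentiable ℝ H := hH.differentiable (by simp)
  have hdd (j : ι) : Differentiable ℝ (partialDeriv j H) :=
    (contDiff_partialDeriv hH j).differentiable (by simp)
  simp [hess, Fintype.sum_sum_type, funext (partialDeriv_inl_comp_baseProj (κ := κ) hd _),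
    partialDeriv_inl_comp_baseProj (hdd j),
    christoffel_warpedMetric_inl_inl_inl hgB hf0 hgF,
    christoffel_warpedMetric_inr_inl_inl hgB hf0 hgF]

omit hf in
lemma hess_comp_baseProj_inl_inr (hH : ContDiff ℝ ∞ H) (i : ι) (b : κ) (p : ι ⊕ κ → ℝ) :
    hess (warpedMetric gB f gF) (fun q => H (baseProj q)) (.inl i) (.inr b) p = 0 := by
  have hd : Differentiable ℝ H := hH.differentiable (by simp)
  simp [hess, Fintype.sum_sum_type, funext (partialDeriv_inr_comp_baseProj (κ := κ) hd _),
    partialDeriv_const, christoffel_warpedMetric_inl_inl_inr hgB hf0 hgF]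

lemma hess_comp_baseProj_inr_inl (hH : ContDiff ℝ ∞ H) (a : κ) (j : ι) (p : ι ⊕ κ → ℝ) :
    hess (warpedMetric gB f gF) (fun q => H (baseProj q)) (.inr a) (.inl j) p = 0 := by
  rw [(hgB.warpedMetric hf hf0 hgF).hess_comm
    (F := fun q => H (baseProj q)) (hH.comp contDiff_baseProj),
    hess_comp_baseProj_inl_inr hgB hf0 hgF hH]

lemma hess_comp_baseProj_inr_inr (hH : ContDiff ℝ ∞ H) (a b : κ) (p : ι ⊕ κ → ℝ) :
    hess (warpedMetric gB f gF) (fun q => H (baseProj q)) (.inr a) (.inr b) p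
      = f (baseProj p) * metricInner gB (baseProj p) (grad gB f (baseProj p))
          (grad gB H (baseProj p)) * gF (fiberProj p) a b := by
  have hd : Differentiable ℝ H := hH.differentiable (by simp)
  rw [hgB.metricInner_grad_right]
  simp only [hess, Fintype.sum_sum_type, funext (partialDeriv_inr_comp_baseProj (κ := κ) hd _),
    partialDeriv_const, partialDeriv_inl_comp_baseProj hd,
    christoffel_warpedMetric_inl_inr_inr hgB hf hf0 hgF, mul_zero, Finset.sum_const_zero, add_zero,
    zero_sub, ← Finset.sum_neg_distrib, Finset.mul_sum, Finset.sum_mul]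
  exact Finset.sum_congr rfl fun k _ => by ring

omit hf in
lemma hess_comp_fiberProj_inl_inl (hU : ContDiff ℝ ∞ U) (i j : ι) (p : ι ⊕ κ → ℝ) :
    hess (warpedMetric gB f gF) (fun q => U (fiberProj q)) (.inl i) (.inl j) p = 0 := by
  have hd : Differentiable ℝ U := hU.differentiable (by simp)
  simp [hess, Fintype.sum_sum_type, funext (partialDeriv_inl_comp_fiberProj (ι := ι) hd _),
    partialDeriv_const, christoffel_warpedMetric_inr_inl_inl hgB hf0 hgF]

lemma hess_comp_fiberProj_inr_inr (hU : ContDiff ℝ ∞ U) (a b : κ) (p : ι ⊕ κ → ℝ) :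
    hess (warpedMetric gB f gF) (fun q => U (fiberProj q)) (.inr a) (.inr b) p
      = hess gF U a b (fiberProj p) := by
  have hd : Differentiable ℝ U := hU.differentiable (by simp)
  have hdd (b : κ) : Differentiable ℝ (partialDeriv b U) :=
    (contDiff_partialDeriv hU b).differentiable (by simp)
  simp [hess, Fintype.sum_sum_type, funext (partialDeriv_inr_comp_fiberProj (ι := ι) hd _),
    partialDeriv_inr_comp_fiberProj (hdd b), partialDeriv_inl_comp_fiberProj hd,
    christoffel_warpedMetric_inr_inr_inr hgB hf hf0 hgF]

lemma tension_comp_fiberProj (hU : ContDiff ℝ ∞ U) (p : ι ⊕ κ → ℝ) :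
    tension (warpedMetric gB f gF) (fun q => U (fiberProj q)) p
      = (f (baseProj p) ^ 2)⁻¹ * tension gF U (fiberProj p) := by
  simp [tension, Fintype.sum_sum_type, warpedMetric_inv hgB hf0 hgF,
    hess_comp_fiberProj_inl_inl hgB hf0 hgF hU, hess_comp_fiberProj_inr_inr hgB hf hf0 hgF hU,
    Finset.mul_sum, mul_assoc]

lemma metricInner_grad_comp_fiberProj_grad_comp_baseProj (hH : ContDiff ℝ ∞ H)
    (hU : ContDiff ℝ ∞ U) (p : ι ⊕ κ → ℝ) :
    metricInner (warpedMetric gB f gF) p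
        (grad (warpedMetric gB f gF) (fun q => U (fiberProj q)) p)
        (grad (warpedMetric gB f gF) (fun q => H (baseProj q)) p) = 0 := by
  have hdU : Differentiable ℝ U := hU.differentiable (by simp)
  have hdH : Differentiable ℝ H := hH.differentiable (by simp)
  rw [(hgB.warpedMetric hf hf0 hgF).metricInner_grad_right]
  simp [Fintype.sum_sum_type, grad, warpedMetric_inv hgB hf0 hgF,
    partialDeriv_inl_comp_fiberProj hdU, partialDeriv_inr_comp_baseProj hdH]

lemma ricci_eq_warpedMetric_inl_inl_iff (hH : ContDiff ℝ ∞ H) (hU : ContDiff ℝ ∞ U) {θ lam : ℝ}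
    (i j : ι) (p : ι ⊕ κ → ℝ) :
    ricci (warpedMetric gB f gF) (.inl i) (.inl j) p
        + hess (warpedMetric gB f gF) (fun q => H (baseProj q)) (.inl i) (.inl j) p
        - θ * (partialDeriv (.inl i) (fun q => U (fiberProj q)) p
          * partialDeriv (.inl j) (fun q => U (fiberProj q)) p)
        = lam * warpedMetric gB f gF p (.inl i) (.inl j) ↔
      ricci gB i j (baseProj p) + hess gB H i j (baseProj p)
        - Fintype.card κ / f (baseProj p) * hess gB f i j (baseProj p)
        = lam * gB (baseProj p) i j := by
  have hdU : Differentiable ℝ U := hU.differentiable (by simp)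
  rw [ricci_warpedMetric_inl_inl hgB hf hf0 hgF, hess_comp_baseProj_inl_inl hgB hf0 hgF hH,
    partialDeriv_inl_comp_fiberProj hdU, zero_mul, mul_zero, sub_zero, sub_add_eq_add_sub,
    warpedMetric, Matrix.fromBlocks_apply₁₁]

lemma ricci_eq_warpedMetric_inr_inr_iff (hH : ContDiff ℝ ∞ H) (hU : ContDiff ℝ ∞ U) {θ lam : ℝ}
    (a b : κ) (p : ι ⊕ κ → ℝ) :
    ricci (warpedMetric gB f gF) (.inr a) (.inr b) p
        + hess (warpedMetric gB f gF) (fun q => H (baseProj q)) (.inr a) (.inr b) p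
        - θ * (partialDeriv (.inr a) (fun q => U (fiberProj q)) p
          * partialDeriv (.inr b) (fun q => U (fiberProj q)) p)
        = lam * warpedMetric gB f gF p (.inr a) (.inr b) ↔
      ricci gF a b (fiberProj p)
        - θ * (partialDeriv a U (fiberProj p) * partialDeriv b U (fiberProj p))
        = (lam * f (baseProj p) ^ 2 + f (baseProj p) * tension gB f (baseProj p)
          + (Fintype.card κ - 1) *
            metricInner gB (baseProj p) (grad gB f (baseProj p)) (grad gB f (baseProj p))
          - f (baseProj p) *
            metricInner gB (baseProj p) (grad gB f (baseProj p)) (grad gB H (baseProj p)))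
          * gF (fiberProj p) a b := by
  have hdU : Differentiable ℝ U := hU.differentiable (by simp)
  rw [ricci_warpedMetric_inr_inr hgB hf hf0 hgF, hess_comp_baseProj_inr_inr hgB hf hf0 hgF hH,
    partialDeriv_inr_comp_fiberProj hdU, partialDeriv_inr_comp_fiberProj hdU, warpedMetric,
    Matrix.fromBlocks_apply₂₂, Matrix.smul_apply, smul_eq_mul]
  constructor <;> intro hab <;> linear_combination hab

lemma tension_eq_warpedMetric_iff (hH : ContDiff ℝ ∞ H) (hU : ContDiff ℝ ∞ U) (p : ι ⊕ κ → ℝ) :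
    tension (warpedMetric gB f gF) (fun q => U (fiberProj q)) p
        - metricInner (warpedMetric gB f gF) p
          (grad (warpedMetric gB f gF) (fun q => U (fiberProj q)) p)
          (grad (warpedMetric gB f gF) (fun q => H (baseProj q)) p) = 0 ↔
      tension gF U (fiberProj p) = 0 := by
  rw [tension_comp_fiberProj hgB hf hf0 hgF hU,
    metricInner_grad_comp_fiberProj_grad_comp_baseProj hgB hf hf0 hgF hH hU, sub_zero,
    mul_eq_zero_iff_left (inv_ne_zero (pow_ne_zero 2 (hf0 _)))]

theorem isGRHS_warpedMetric_iff (hH : ContDiff ℝ ∞ H) (hU : ContDiff ℝ ∞ U) {θ lam : ℝ}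
    (hθ : 0 ≤ θ) :
    IsGRHS (warpedMetric gB f gF) (fun p => H (baseProj p)) (fun p => U (fiberProj p)) θ lam ↔
      (∀ x i j, ricci gB i j x + hess gB H i j x - Fintype.card κ / f x * hess gB f i j x
        = lam * gB x i j) ∧
      (∀ x y a b, ricci gF a b y - θ * (partialDeriv a U y * partialDeriv b U y)
        = (lam * f x ^ 2 + f x * tension gB f x
            + (Fintype.card κ - 1) * metricInner gB x (grad gB f x) (grad gB f x)
            - f x * metricInner gB x (grad gB f x) (grad gB H x)) * gF y a b) ∧
      ∀ y, tension gF U y = 0 := by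
  have hdU : Differentiable ℝ U := hU.differentiable (by simp)
  have hbase := ricci_eq_warpedMetric_inl_inl_iff hgB hf hf0 hgF hH hU (θ := θ) (lam := lam)
  have hfiber := ricci_eq_warpedMetric_inr_inr_iff hgB hf hf0 hgF hH hU (θ := θ) (lam := lam)
  have htension := tension_eq_warpedMetric_iff hgB hf hf0 hgF hH hU
  constructor
  · exact fun hsol =>
      ⟨fun x i j => (hbase i j (Sum.elim x 0)).1 (hsol.ricci_eq _ _ _),
        fun x y a b => (hfiber a b (Sum.elim x y)).1 (hsol.ricci_eq _ _ _),
        fun y => (htension (Sum.elim 0 y)).1 (hsol.tension_eq _)⟩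
  · rintro ⟨hB, hF, hT⟩
    refine ⟨hgB.warpedMetric hf hf0 hgF, hH.comp contDiff_baseProj, hU.comp contDiff_fiberProj, hθ,
      ?_, fun p => (htension p).2 (hT _)⟩
    rintro p (i | a) (j | b)
    · exact (hbase i j p).2 (hB _ i j)
    · rw [ricci_warpedMetric_inl_inr hgB hf hf0 hgF, hess_comp_baseProj_inl_inr hgB hf0 hgF hH,
        partialDeriv_inl_comp_fiberProj hdU]
      simp [warpedMetric]
    · rw [ricci_warpedMetric_inr_inl hgB hf hf0 hgF, hess_comp_baseProj_inr_inl hgB hf hf0 hgF hH,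
        partialDeriv_inl_comp_fiberProj hdU]
      simp [warpedMetric]
    · exact (hfiber a b p).2 (hF _ _ a b)

end Functions

end WarpedProduct

section ConformalMetric

variable {ι : Type*} [DecidableEq ι]

/-- The tensor `δᵏⱼ wᵢ + δᵏᵢ wⱼ - (g₀)ᵢⱼ (g₀)ᵏˡ wₗ`, minus the Christoffel symbol `Γᵏᵢⱼ` of
`ψ⁻² g₀` when `w` is the logarithmic differential of `ψ`. -/
def conformalSymbol (ε w : ι → ℝ) (k i j : ι) : ℝ :=
  (1 : Matrix ι ι ℝ) k j * w i + (1 : Matrix ι ι ℝ) k i * w j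
    - Matrix.diagonal ε i j * (ε k * w k)

lemma conformalSymbol_comm (ε w : ι → ℝ) (k i j : ι) :
    conformalSymbol ε w k i j = conformalSymbol ε w k j i := by
  rw [conformalSymbol, conformalSymbol, ← Matrix.diagonal_transpose ε, Matrix.transpose_apply,
    Matrix.diagonal_transpose, add_comm]

lemma mul_diagonal_apply_eq_one_apply {ε : ι → ℝ} (hε : ∀ i, ε i * ε i = 1) (k j : ι) :
    ε k * Matrix.diagonal ε k j = (1 : Matrix ι ι ℝ) k j := by
  obtain rfl | hkj := eq_or_ne k j
  · simp [hε]
  · simp [hkj]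

lemma partialDeriv_conformalSymbol [Finite ι] {w : (ι → ℝ) → ι → ℝ} {x : ι → ℝ}
    (hw : ∀ i, DifferentiableAt ℝ (fun y => w y i) x) (ε : ι → ℝ) (l k i j : ι) :
    partialDeriv l (fun y => conformalSymbol ε (w y) k i j) x
      = conformalSymbol ε (fun r => partialDeriv l (fun y => w y r) x) k i j := by
  cases nonempty_fintype ι
  simp only [conformalSymbol]
  rw [partialDeriv_sub l (((hw i).const_mul _).fun_add ((hw j).const_mul _))
      (((hw k).const_mul _).const_mul _),
    partialDeriv_add l ((hw i).const_mul _) ((hw j).const_mul _), partialDeriv_const_mul l _ (hw i),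
    partialDeriv_const_mul l _ (hw j), partialDeriv_const_mul l _ ((hw k).const_mul _),
    partialDeriv_const_mul l _ (hw k)]

variable [Fintype ι]

section Contractions

variable {ε : ι → ℝ}

lemma diagonal_mul_self (hε : ∀ i, ε i * ε i = 1) :
    Matrix.diagonal ε * Matrix.diagonal ε = 1 := by
  simp [hε]

lemma sum_mul_conformalSymbol (ε v w : ι → ℝ) (i j : ι) :
    ∑ k, v k * conformalSymbol ε w k i j
      = v j * w i + v i * w j - Matrix.diagonal ε i j * ∑ k, ε k * (v k * w k) := by
  simp only [conformalSymbol, Matrix.one_apply, mul_sub, mul_add, Finset.sum_sub_distrib,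
    Finset.sum_add_distrib, Finset.mul_sum, ite_mul, mul_ite, one_mul, zero_mul, mul_zero,
    Finset.sum_ite_eq', Finset.mem_univ, if_true]
  congr 1
  exact Finset.sum_congr rfl fun k _ => by ring

lemma sum_conformalSymbol_diag (ε : ι → ℝ) (v : ι → ι → ℝ) (j k : ι) :
    ∑ i, conformalSymbol ε (v i) i j k
      = v k j + v j k - Matrix.diagonal ε j k * ∑ i, ε i * v i i := by
  simp [conformalSymbol, Matrix.one_apply, Finset.sum_add_distrib, Finset.mul_sum]

lemma sum_conformalSymbol_self (hε : ∀ i, ε i * ε i = 1) (w : ι → ℝ) (j : ι) :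
    ∑ i, conformalSymbol ε w i i j = Fintype.card ι * w j := by
  have hdiag (i : ι) : Matrix.diagonal ε i j * (ε i * w i) = (1 : Matrix ι ι ℝ) i j * w i := by
    rw [← mul_diagonal_apply_eq_one_apply hε]
    ring
  simp [conformalSymbol, hdiag]

lemma sum_mul_conformalSymbol_right (hε : ∀ i, ε i * ε i = 1) (w : ι → ℝ) (i j : ι) :
    ∑ p, ε p * (conformalSymbol ε w i j p * w p) = (1 : Matrix ι ι ℝ) i j * sqNorm ε w := by
  simp only [conformalSymbol, Matrix.one_apply, Matrix.diagonal_apply, mul_sub, sub_mul, mul_add,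
    add_mul, Finset.sum_sub_distrib, Finset.sum_add_distrib, ite_mul, mul_ite, one_mul, zero_mul,
    mul_zero, Finset.sum_ite_eq, Finset.sum_ite_irrel, Finset.sum_const_zero, Finset.mem_univ,
    if_true, sqNorm, pow_two]
  linear_combination -(ε i * w i * w j) * hε j

lemma sum_conformalSymbol_mul_conformalSymbol (hε : ∀ i, ε i * ε i = 1) (w : ι → ℝ) (j k : ι) :
    ∑ i, ∑ p, conformalSymbol ε w i j p * conformalSymbol ε w p i k
      = (Fintype.card ι + 2) * (w j * w k) - 2 * (Matrix.diagonal ε j k * sqNorm ε w) := by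
  have hraise (i : ι) : Matrix.diagonal ε i k * ((1 : Matrix ι ι ℝ) i j * sqNorm ε w)
      = (1 : Matrix ι ι ℝ) i j * (Matrix.diagonal ε j k * sqNorm ε w) := by
    obtain rfl | hij := eq_or_ne i j
    · ring
    · simp [hij]
  have hfree : ∑ i, conformalSymbol ε w i j k * w i
      = 2 * (w j * w k) - Matrix.diagonal ε j k * sqNorm ε w := by
    rw [Finset.sum_congr rfl fun i _ => mul_comm (conformalSymbol ε w i j k) (w i),
      sum_mul_conformalSymbol]
    simp only [sqNorm, pow_two]
    ring
  simp only [sum_mul_conformalSymbol, sum_mul_conformalSymbol_right hε, hraise,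
    Finset.sum_sub_distrib, Finset.sum_add_distrib, hfree, ← Finset.sum_mul]
  have htrace : ∑ i, conformalSymbol ε w i j i = Fintype.card ι * w j := by
    simp only [conformalSymbol_comm ε w _ j, sum_conformalSymbol_self hε]
  have hone : ∑ i, (1 : Matrix ι ι ℝ) i j = 1 := by simp [Matrix.one_apply]
  rw [htrace, hone]
  ring

end Contractions

variable {ε : ι → ℝ} {ψ : (ι → ℝ) → ℝ}

variable (hε : ∀ i, ε i * ε i = 1) (hψ : ContDiff ℝ ∞ ψ) (hψ0 : ∀ x, ψ x ≠ 0)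

include hε hψ0 in
lemma conformalMetric_mul_smul_diagonal (x : ι → ℝ) :
    conformalMetric ε ψ x * ψ x ^ 2 • Matrix.diagonal ε = 1 := by
  rw [conformalMetric, Matrix.smul_mul, Matrix.mul_smul, smul_smul, diagonal_mul_self hε,
    inv_mul_cancel₀ (pow_ne_zero 2 (hψ0 x)), one_smul]

include hε hψ0 in
lemma conformalMetric_inv (x : ι → ℝ) :
    (conformalMetric ε ψ x)⁻¹ = ψ x ^ 2 • Matrix.diagonal ε :=
  Matrix.inv_eq_right_inv (conformalMetric_mul_smul_diagonal hε hψ0 x)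

include hε hψ hψ0

lemma isSemiRiemannianMetric_conformalMetric : IsSemiRiemannianMetric (conformalMetric ε ψ) where
  smooth _ _ := ((hψ.pow 2).inv fun x => pow_ne_zero 2 (hψ0 x)).mul contDiff_const
  symm _ := (Matrix.isSymm_diagonal ε).smul _
  nondegenerate x := (Matrix.isUnit_iff_isUnit_det _).1 <|
    IsUnit.of_mul_eq_one _ (conformalMetric_mul_smul_diagonal hε hψ0 x)

omit hε in
lemma partialDeriv_conformalMetric (l i j : ι) (x : ι → ℝ) :
    partialDeriv l (fun y => conformalMetric ε ψ y i j) x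
      = -2 * (ψ x ^ 2)⁻¹ * (partialDeriv l ψ x / ψ x) * Matrix.diagonal ε i j := by
  have hd : Differentiable ℝ ψ := hψ.differentiable (by simp)
  have hinv : Differentiable ℝ fun y => (ψ y ^ 2)⁻¹ :=
    (hd.fun_pow 2).fun_inv fun y => pow_ne_zero 2 (hψ0 y)
  have hψx := hψ0 x
  have hderiv : HasDerivAt (fun s : ℝ => (s ^ 2)⁻¹) (-(2 * ψ x) / (ψ x ^ 2) ^ 2) (ψ x) := by
    simpa using (hasDerivAt_pow 2 (ψ x)).fun_inv (pow_ne_zero 2 hψx)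
  simp only [conformalMetric, Matrix.smul_apply, smul_eq_mul, mul_comm _ (Matrix.diagonal ε i j)]
  rw [partialDeriv_const_mul l _ (hinv x),
    partialDeriv_comp (φ := fun s => (s ^ 2)⁻¹) l hderiv.differentiableAt (hd x), hderiv.deriv]
  field_simp

lemma christoffel_conformalMetric (k i j : ι) :
    christoffel (conformalMetric ε ψ) k i j
      = fun x => -conformalSymbol ε (fun l => partialDeriv l ψ x / ψ x) k i j := by
  funext x
  have hψx := hψ0 x
  have hlower (j : ι) : Matrix.diagonal ε j k * ε k = (1 : Matrix ι ι ℝ) k j := by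
    rw [← mul_diagonal_apply_eq_one_apply hε, ← Matrix.diagonal_transpose ε,
      Matrix.transpose_apply, Matrix.diagonal_transpose, mul_comm]
  have hsum : ∑ l, Matrix.diagonal ε k l * (Matrix.diagonal ε j l * (partialDeriv i ψ x / ψ x)
        + Matrix.diagonal ε i l * (partialDeriv j ψ x / ψ x)
        - Matrix.diagonal ε i j * (partialDeriv l ψ x / ψ x))
      = conformalSymbol ε (fun l => partialDeriv l ψ x / ψ x) k i j := by
    refine (diagonal_dotProduct ..).trans ?_
    rw [conformalSymbol, ← hlower, ← hlower]
    ring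
  rw [← hsum, christoffel, Finset.mul_sum, ← Finset.sum_neg_distrib]
  simp only [conformalMetric_inv hε hψ0, partialDeriv_conformalMetric hψ hψ0, Matrix.smul_apply,
    smul_eq_mul]
  refine Finset.sum_congr rfl fun l _ => ?_
  field_simp
  ring

lemma christoffelTrace_conformalMetric (k : ι) :
    christoffelTrace (conformalMetric ε ψ) k
      = fun x => -Fintype.card ι * (partialDeriv k ψ x / ψ x) := by
  funext x
  simp [christoffelTrace, christoffel_conformalMetric hε hψ hψ0, sum_conformalSymbol_self hε]

lemma hess_conformalMetric (F : (ι → ℝ) → ℝ) (i j : ι) (x : ι → ℝ) :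
    hess (conformalMetric ε ψ) F i j x
      = partialDeriv i (partialDeriv j F) x
        + (partialDeriv i ψ x * partialDeriv j F x + partialDeriv j ψ x * partialDeriv i F x) / ψ x
        - Matrix.diagonal ε i j
          * ((∑ k, ε k * (partialDeriv k ψ x * partialDeriv k F x)) / ψ x) := by
  have hcontract := sum_mul_conformalSymbol ε (fun k => partialDeriv k F x)
    (fun k => partialDeriv k ψ x / ψ x) i j
  have hsum : ∑ k, ε k * (partialDeriv k F x * (partialDeriv k ψ x / ψ x))
      = (∑ k, ε k * (partialDeriv k ψ x * partialDeriv k F x)) / ψ x := by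
    rw [Finset.sum_div]
    exact Finset.sum_congr rfl fun k _ => by ring
  simp only [hess, christoffel_conformalMetric hε hψ hψ0, neg_mul, Finset.sum_neg_distrib,
    mul_comm (conformalSymbol _ _ _ _ _), hcontract, hsum]
  ring

omit hψ in
lemma grad_conformalMetric (F : (ι → ℝ) → ℝ) (x : ι → ℝ) :
    grad (conformalMetric ε ψ) F x = fun i => ψ x ^ 2 * (ε i * partialDeriv i F x) := by
  funext i
  simp [grad, conformalMetric_inv hε hψ0, Matrix.diagonal_apply, mul_assoc]

lemma metricInner_grad_conformalMetric (F G : (ι → ℝ) → ℝ) (x : ι → ℝ) :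
    metricInner (conformalMetric ε ψ) x (grad (conformalMetric ε ψ) F x)
        (grad (conformalMetric ε ψ) G x)
      = ψ x ^ 2 * ∑ i, ε i * (partialDeriv i F x * partialDeriv i G x) := by
  rw [(isSemiRiemannianMetric_conformalMetric hε hψ hψ0).metricInner_grad_right,
    grad_conformalMetric hε hψ0, Finset.mul_sum]
  exact Finset.sum_congr rfl fun i _ => by ring

lemma tension_conformalMetric (F : (ι → ℝ) → ℝ) (x : ι → ℝ) :
    tension (conformalMetric ε ψ) F x
      = ψ x ^ 2 * ∑ i, ε i * partialDeriv i (partialDeriv i F) x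
        - (Fintype.card ι - 2) * ψ x * ∑ i, ε i * (partialDeriv i ψ x * partialDeriv i F x) := by
  have hψx := hψ0 x
  have htrace : tension (conformalMetric ε ψ) F x
      = ψ x ^ 2 * ∑ i, ε i * hess (conformalMetric ε ψ) F i i x := by
    simp only [tension, conformalMetric_inv hε hψ0, Matrix.smul_apply, smul_eq_mul, mul_assoc,
      ← Finset.mul_sum]
    congr 1
    exact Finset.sum_congr rfl fun i _ => diagonal_dotProduct ..
  simp only [htrace, hess_conformalMetric hε hψ hψ0, Matrix.diagonal_apply_eq, mul_sub, mul_add,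
    Finset.sum_sub_distrib, Finset.sum_add_distrib, ← mul_assoc, hε, one_mul, Finset.sum_const,
    Finset.card_univ, nsmul_eq_mul]
  have hcross : ∑ i, ε i * ((partialDeriv i ψ x * partialDeriv i F x
      + partialDeriv i ψ x * partialDeriv i F x) / ψ x)
        = 2 * (∑ i, ε i * partialDeriv i ψ x * partialDeriv i F x) / ψ x := by
    rw [Finset.mul_sum, Finset.sum_div]
    exact Finset.sum_congr rfl fun i _ => by ring
  rw [hcross]
  field_simp
  ring

omit hε in
lemma partialDeriv_partialDeriv_div (i j : ι) (x : ι → ℝ) :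
    partialDeriv i (fun y => partialDeriv j ψ y / ψ y) x
      = partialDeriv i (partialDeriv j ψ) x / ψ x
        - partialDeriv i ψ x / ψ x * (partialDeriv j ψ x / ψ x) := by
  rw [partialDeriv_div i ((contDiff_partialDeriv hψ j).differentiable (by simp) x)
    (hψ.differentiable (by simp) x) (hψ0 x)]
  ring

lemma sum_partialDeriv_christoffel_conformalMetric (j k : ι) (x : ι → ℝ) :
    ∑ i, partialDeriv i (christoffel (conformalMetric ε ψ) i j k) x
      = Matrix.diagonal ε j k
          * ∑ i, ε i * partialDeriv i (fun y => partialDeriv i ψ y / ψ y) x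
        - 2 * partialDeriv j (fun y => partialDeriv k ψ y / ψ y) x := by
  have hw (l : ι) : Differentiable ℝ fun y => partialDeriv l ψ y / ψ y :=
    ((contDiff_partialDeriv hψ l).div hψ hψ0).differentiable (by simp)
  have hswap : partialDeriv k (fun y => partialDeriv j ψ y / ψ y) x
      = partialDeriv j (fun y => partialDeriv k ψ y / ψ y) x := by
    simp only [partialDeriv_partialDeriv_div hψ hψ0, partialDeriv_comm hψ k j,
      mul_comm (partialDeriv k ψ x / ψ x)]
  have hderiv (i : ι) : partialDeriv i (christoffel (conformalMetric ε ψ) i j k) x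
      = -conformalSymbol ε (fun l => partialDeriv i (fun y => partialDeriv l ψ y / ψ y) x)
          i j k := by
    rw [christoffel_conformalMetric hε hψ hψ0, partialDeriv_neg,
      partialDeriv_conformalSymbol fun l => hw l x]
  simp only [hderiv, Finset.sum_neg_distrib, sum_conformalSymbol_diag, hswap]
  ring

theorem ricci_conformalMetric (j k : ι) (x : ι → ℝ) :
    ricci (conformalMetric ε ψ) j k x
      = (Fintype.card ι - 2) * (partialDeriv j (partialDeriv k ψ) x / ψ x)
        + Matrix.diagonal ε j k *
          ((∑ i, ε i * partialDeriv i (partialDeriv i ψ) x) / ψ x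
            - (Fintype.card ι - 1) * sqNorm ε (fun i => partialDeriv i ψ x / ψ x)) := by
  have hw : Differentiable ℝ fun y => partialDeriv k ψ y / ψ y :=
    ((contDiff_partialDeriv hψ k).div hψ hψ0).differentiable (by simp)
  have hsq : ∑ i, ε i * (partialDeriv i ψ x / ψ x * (partialDeriv i ψ x / ψ x))
      = sqNorm ε fun i => partialDeriv i ψ x / ψ x := by simp only [sqNorm, pow_two]
  have htrace : ∑ p, christoffelTrace (conformalMetric ε ψ) p x
      * christoffel (conformalMetric ε ψ) p j k x
        = Fintype.card ι * (2 * (partialDeriv j ψ x / ψ x * (partialDeriv k ψ x / ψ x))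
          - Matrix.diagonal ε j k * sqNorm ε fun i => partialDeriv i ψ x / ψ x) := by
    simp only [christoffelTrace_conformalMetric hε hψ hψ0, christoffel_conformalMetric hε hψ hψ0,
      mul_assoc, ← Finset.mul_sum, neg_mul, mul_neg, neg_neg,
      sum_mul_conformalSymbol, hsq]
    ring
  have hlaplace : ∑ i, ε i * partialDeriv i (fun y => partialDeriv i ψ y / ψ y) x
      = (∑ i, ε i * partialDeriv i (partialDeriv i ψ) x) / ψ x
        - sqNorm ε fun i => partialDeriv i ψ x / ψ x := by
    simp only [partialDeriv_partialDeriv_div hψ hψ0, mul_sub, Finset.sum_sub_distrib, hsq,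
      Finset.sum_div, mul_div_assoc]
  rw [(isSemiRiemannianMetric_conformalMetric hε hψ hψ0).ricci_eq_sum_christoffel,
    sum_partialDeriv_christoffel_conformalMetric hε hψ hψ0, htrace, hlaplace,
    christoffelTrace_conformalMetric hε hψ hψ0, partialDeriv_const_mul j _ (hw x)]
  simp only [christoffel_conformalMetric hε hψ hψ0, neg_mul_neg,
    sum_conformalSymbol_mul_conformalSymbol hε, partialDeriv_partialDeriv_div hψ hψ0]
  ring

end ConformalMetric

section TranslationInvariant

variable {ι : Type*} [Fintype ι] [DecidableEq ι] {ε : ι → ℝ} {φ F G : ℝ → ℝ}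

lemma sum_mul_partialDeriv_comp_linFun (ε : ι → ℝ) (hF : Differentiable ℝ F)
    (hG : Differentiable ℝ G) (a x : ι → ℝ) :
    ∑ i, ε i * (partialDeriv i (fun y => F (linFun a y)) x
        * partialDeriv i (fun y => G (linFun a y)) x)
      = deriv F (linFun a x) * deriv G (linFun a x) * sqNorm ε a := by
  simp only [partialDeriv_comp_linFun hF, partialDeriv_comp_linFun hG, sqNorm, Finset.mul_sum]
  exact Finset.sum_congr rfl fun i _ => by ring

lemma sum_partialDeriv_partialDeriv_comp_linFun (ε : ι → ℝ) (hF : ContDiff ℝ ∞ F) (a x : ι → ℝ) :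
    ∑ i, ε i * partialDeriv i (partialDeriv i fun y => F (linFun a y)) x
      = deriv (deriv F) (linFun a x) * sqNorm ε a := by
  simp only [partialDeriv_partialDeriv_comp_linFun hF, sqNorm, Finset.mul_sum]
  exact Finset.sum_congr rfl fun i _ => by ring

variable (hε : ∀ i, ε i * ε i = 1) (hφ : ContDiff ℝ ∞ φ) (hφ0 : ∀ s, φ s ≠ 0) (a : ι → ℝ)

include hε hφ hφ0

lemma ricci_conformalMetric_comp_linFun (i j : ι) (x : ι → ℝ) :
    ricci (conformalMetric ε fun y => φ (linFun a y)) i j x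
      = (Fintype.card ι - 2) * (deriv (deriv φ) (linFun a x) / φ (linFun a x)) * (a i * a j)
        + (deriv (deriv φ) (linFun a x) / φ (linFun a x)
            - (Fintype.card ι - 1) * (deriv φ (linFun a x) / φ (linFun a x)) ^ 2) * sqNorm ε a
          * Matrix.diagonal ε i j := by
  have hd : Differentiable ℝ φ := hφ.differentiable (by simp)
  have hsq : sqNorm ε (fun i => partialDeriv i (fun y => φ (linFun a y)) x / φ (linFun a x))
      = (deriv φ (linFun a x) / φ (linFun a x)) ^ 2 * sqNorm ε a := by
    simp only [sqNorm, partialDeriv_comp_linFun hd, Finset.mul_sum]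
    exact Finset.sum_congr rfl fun i _ => by ring
  rw [ricci_conformalMetric hε (contDiff_comp_linFun hφ a) fun x => hφ0 _,
    partialDeriv_partialDeriv_comp_linFun hφ, sum_partialDeriv_partialDeriv_comp_linFun ε hφ, hsq]
  ring

lemma hess_conformalMetric_comp_linFun (hF : ContDiff ℝ ∞ F) (i j : ι) (x : ι → ℝ) :
    hess (conformalMetric ε fun y => φ (linFun a y)) (fun y => F (linFun a y)) i j x
      = (deriv (deriv F) (linFun a x)
          + 2 * (deriv φ (linFun a x) / φ (linFun a x)) * deriv F (linFun a x)) * (a i * a j)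
        - deriv φ (linFun a x) / φ (linFun a x) * deriv F (linFun a x) * sqNorm ε a
          * Matrix.diagonal ε i j := by
  have hd : Differentiable ℝ φ := hφ.differentiable (by simp)
  have hdF : Differentiable ℝ F := hF.differentiable (by simp)
  rw [hess_conformalMetric hε (contDiff_comp_linFun hφ a) fun x => hφ0 _,
    sum_mul_partialDeriv_comp_linFun ε hd hdF, partialDeriv_partialDeriv_comp_linFun hF]
  simp only [partialDeriv_comp_linFun hd, partialDeriv_comp_linFun hdF]
  ring

lemma tension_conformalMetric_comp_linFun (hF : ContDiff ℝ ∞ F) (x : ι → ℝ) :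
    tension (conformalMetric ε fun y => φ (linFun a y)) (fun y => F (linFun a y)) x
      = (φ (linFun a x) ^ 2 * deriv (deriv F) (linFun a x)
          - (Fintype.card ι - 2) * φ (linFun a x) * deriv φ (linFun a x) * deriv F (linFun a x))
        * sqNorm ε a := by
  rw [tension_conformalMetric hε (contDiff_comp_linFun hφ a) fun x => hφ0 _,
    sum_mul_partialDeriv_comp_linFun ε (hφ.differentiable (by simp)) (hF.differentiable (by simp)),
    sum_partialDeriv_partialDeriv_comp_linFun ε hF]
  ring

lemma metricInner_grad_conformalMetric_comp_linFun (hF : Differentiable ℝ F)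
    (hG : Differentiable ℝ G) (x : ι → ℝ) :
    metricInner (conformalMetric ε fun y => φ (linFun a y)) x
        (grad (conformalMetric ε fun y => φ (linFun a y)) (fun y => F (linFun a y)) x)
        (grad (conformalMetric ε fun y => φ (linFun a y)) (fun y => G (linFun a y)) x)
      = φ (linFun a x) ^ 2 * deriv F (linFun a x) * deriv G (linFun a x) * sqNorm ε a := by
  rw [metricInner_grad_conformalMetric hε (contDiff_comp_linFun hφ a) fun x => hφ0 _,
    sum_mul_partialDeriv_comp_linFun ε hF hG]
  ring

lemma tension_add_metricInner_conformalMetric_comp_linFun {f h : ℝ → ℝ} (hf : ContDiff ℝ ∞ f)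
    (hh : Differentiable ℝ h) (m lam : ℝ) (x : ι → ℝ) :
    lam * f (linFun a x) ^ 2
        + f (linFun a x)
          * tension (conformalMetric ε fun y => φ (linFun a y)) (fun y => f (linFun a y)) x
        + (m - 1) * metricInner (conformalMetric ε fun y => φ (linFun a y)) x
          (grad (conformalMetric ε fun y => φ (linFun a y)) (fun y => f (linFun a y)) x)
          (grad (conformalMetric ε fun y => φ (linFun a y)) (fun y => f (linFun a y)) x)
        - f (linFun a x) * metricInner (conformalMetric ε fun y => φ (linFun a y)) x
          (grad (conformalMetric ε fun y => φ (linFun a y)) (fun y => f (linFun a y)) x)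
          (grad (conformalMetric ε fun y => φ (linFun a y)) (fun y => h (linFun a y)) x)
      = (deriv (deriv f) (linFun a x) * φ (linFun a x) ^ 2 * f (linFun a x)
            - ((Fintype.card ι : ℝ) - 2) * deriv φ (linFun a x) * φ (linFun a x)
              * f (linFun a x) * deriv f (linFun a x)
            + (m - 1) * deriv f (linFun a x) ^ 2 * φ (linFun a x) ^ 2
            - deriv f (linFun a x) * f (linFun a x) * φ (linFun a x) ^ 2 * deriv h (linFun a x))
          * sqNorm ε a
        + lam * f (linFun a x) ^ 2 := by
  have hdf : Differentiable ℝ f := hf.differentiable (by simp)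
  rw [tension_conformalMetric_comp_linFun hε hφ hφ0 a hf,
    metricInner_grad_conformalMetric_comp_linFun hε hφ hφ0 a hdf hdf,
    metricInner_grad_conformalMetric_comp_linFun hε hφ hφ0 a hdf hh]
  ring

omit [Fintype ι] hφ hφ0 in
lemma mul_add_mul_diagonal_eq_zero_iff [Nontrivial ι] {a : ι → ℝ} (ha : a ≠ 0) (A B : ℝ) :
    (∀ i j, A * (a i * a j) + B * Matrix.diagonal ε i j = 0) ↔ A = 0 ∧ B = 0 := by
  refine ⟨fun hAB => ?_, by rintro ⟨rfl, rfl⟩; simp⟩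
  obtain ⟨i, hi⟩ := Function.ne_iff.1 ha
  obtain ⟨j, hji⟩ := exists_ne i
  have hoff : A * a j = 0 := by
    have hij := hAB i j
    rw [Matrix.diagonal_apply_ne _ hji.symm, mul_zero, add_zero, ← mul_left_comm] at hij
    exact (mul_eq_zero.1 hij).resolve_left hi
  have hB : B = 0 := by
    have hjj := hAB j j
    rw [Matrix.diagonal_apply_eq, ← mul_assoc, hoff, zero_mul, zero_add] at hjj
    exact (mul_eq_zero.1 hjj).resolve_right (left_ne_zero_of_mul_eq_one (hε j))
  have hii := hAB i i
  rw [hB, zero_mul, add_zero] at hii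
  exact ⟨(mul_eq_zero.1 hii).resolve_right (mul_ne_zero hi hi), hB⟩

variable [Nontrivial ι] {a : ι → ℝ} (ha : a ≠ 0)

include ha

lemma ricci_add_hess_sub_hess_eq_smul_conformalMetric_comp_linFun_iff {f h : ℝ → ℝ}
    (hf : ContDiff ℝ ∞ f) (hh : ContDiff ℝ ∞ h) (m lam : ℝ) :
    (∀ x i j, ricci (conformalMetric ε fun y => φ (linFun a y)) i j x
        + hess (conformalMetric ε fun y => φ (linFun a y)) (fun y => h (linFun a y)) i j x
        - m / f (linFun a x)
          * hess (conformalMetric ε fun y => φ (linFun a y)) (fun y => f (linFun a y)) i j x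
        = lam * conformalMetric ε (fun y => φ (linFun a y)) x i j) ↔
      ∀ s,
      ((Fintype.card ι : ℝ) - 2) * (deriv (deriv φ) s / φ s)
          - m * (deriv (deriv f) s / f s)
          - 2 * m * (deriv φ s / φ s)
            * (deriv f s / f s)
          + deriv (deriv h) s
          + 2 * (deriv φ s / φ s) * deriv h s = 0 ∧
        (deriv (deriv φ) s / φ s
          - ((Fintype.card ι : ℝ) - 1) * (deriv φ s / φ s) ^ 2
          + m * (deriv φ s / φ s) * (deriv f s / f s)
          - (deriv φ s / φ s) * deriv h s) * sqNorm ε a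
        = lam / φ s ^ 2 := by
  rw [(linFun_surjective ha).forall]
  refine forall_congr' fun x => ?_
  rw [← sub_eq_zero (b := lam / _), ← mul_add_mul_diagonal_eq_zero_iff hε ha]
  refine forall_congr' fun i => forall_congr' fun j => ?_
  rw [ricci_conformalMetric_comp_linFun hε hφ hφ0, hess_conformalMetric_comp_linFun hε hφ hφ0 a hh,
    hess_conformalMetric_comp_linFun hε hφ hφ0 a hf, conformalMetric, Matrix.smul_apply,
    smul_eq_mul, ← sub_eq_zero]
  constructor <;> intro hij <;> linear_combination hij

lemma ricci_sub_eq_smul_conformalMetric_comp_linFun_iff {u : ℝ → ℝ}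
    (hu : Differentiable ℝ u) (θ c : ℝ) :
    (∀ x i j, ricci (conformalMetric ε fun y => φ (linFun a y)) i j x
        - θ * (partialDeriv i (fun y => u (linFun a y)) x
          * partialDeriv j (fun y => u (linFun a y)) x)
        = c * conformalMetric ε (fun y => φ (linFun a y)) x i j) ↔
      ∀ s,
      c = (φ s * deriv (deriv φ) s
          - ((Fintype.card ι : ℝ) - 1) * deriv φ s ^ 2) * sqNorm ε a ∧
      ((Fintype.card ι : ℝ) - 2) * (deriv (deriv φ) s / φ s)
        - θ * deriv u s ^ 2 = 0 := by
  rw [(linFun_surjective ha).forall]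
  refine forall_congr' fun x => ?_
  have hφx := hφ0 (linFun a x)
  have hscale : c = (φ (linFun a x) * deriv (deriv φ) (linFun a x)
        - ((Fintype.card ι : ℝ) - 1) * deriv φ (linFun a x) ^ 2) * sqNorm ε a ↔
      (deriv (deriv φ) (linFun a x) / φ (linFun a x)
        - ((Fintype.card ι : ℝ) - 1) * (deriv φ (linFun a x) / φ (linFun a x)) ^ 2) * sqNorm ε a
        - c / φ (linFun a x) ^ 2 = 0 := by
    field_simp
    constructor <;> intro hc <;> linear_combination -hc
  rw [hscale, and_comm, ← mul_add_mul_diagonal_eq_zero_iff hε ha]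
  refine forall_congr' fun i => forall_congr' fun j => ?_
  rw [ricci_conformalMetric_comp_linFun hε hφ hφ0, partialDeriv_comp_linFun hu,
    partialDeriv_comp_linFun hu, conformalMetric, Matrix.smul_apply, smul_eq_mul, ← sub_eq_zero]
  constructor <;> intro hij <;> linear_combination hij

omit [Nontrivial ι] in
lemma tension_conformalMetric_comp_linFun_eq_zero_iff (hF : ContDiff ℝ ∞ F) :
    (∀ x, tension (conformalMetric ε fun y => φ (linFun a y)) (fun y => F (linFun a y)) x = 0) ↔
      ∀ s, (φ s ^ 2 * deriv (deriv F) s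
        - (Fintype.card ι - 2) * φ s * deriv φ s * deriv F s) * sqNorm ε a = 0 := by
  rw [(linFun_surjective ha).forall]
  simp only [tension_conformalMetric_comp_linFun hε hφ hφ0 a hF]

end TranslationInvariant

end GRHS

end

open GRHS in
theorem theorem4_general {ι κ : Type*} [Fintype ι] [DecidableEq ι] [Nontrivial ι]
    [Fintype κ] [DecidableEq κ] [Nontrivial κ]
    (ε : ι → ℝ) (hε : ∀ i, ε i = 1 ∨ ε i = -1)
    (δ : κ → ℝ) (hδ : ∀ j, δ j = 1 ∨ δ j = -1)
    (α : ι → ℝ) (hα : α ≠ 0) (β : κ → ℝ) (hβ : β ≠ 0)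
    (θ lam : ℝ) (hθ : 0 ≤ θ)
    (φ f h τ u : ℝ → ℝ)
    (hφ : ContDiff ℝ ∞ φ) (hφ0 : ∀ s, φ s ≠ 0)
    (hf : ContDiff ℝ ∞ f) (hf0 : ∀ s, f s ≠ 0)
    (hh : ContDiff ℝ ∞ h)
    (hτ : ContDiff ℝ ∞ τ) (hτ0 : ∀ t, τ t ≠ 0)
    (hu : ContDiff ℝ ∞ u) :
    (IsGRHS
        (warpedMetric
          (conformalMetric ε (fun x => φ (linFun α x)))
          (fun x => f (linFun α x))
          (conformalMetric δ (fun y => τ (linFun β y))))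
        (fun p => h (linFun α (baseProj p)))
        (fun p => u (linFun β (fiberProj p)))
        θ lam ∧
      ¬ ∃ c : ℝ, ∀ p : ι ⊕ κ → ℝ, u (linFun β (fiberProj p)) = c)
    ↔
    ((¬ ∃ c : ℝ, ∀ t, u t = c) ∧
      (∀ s : ℝ,
        ((Fintype.card ι : ℝ) - 2) * (deriv (deriv φ) s / φ s)
          - Fintype.card κ * (deriv (deriv f) s / f s)
          - 2 * Fintype.card κ * (deriv φ s / φ s) * (deriv f s / f s)
          + deriv (deriv h) s + 2 * (deriv φ s / φ s) * deriv h s = 0) ∧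
      (∀ s : ℝ,
        (deriv (deriv φ) s / φ s - ((Fintype.card ι : ℝ) - 1) * (deriv φ s / φ s) ^ 2
          + Fintype.card κ * (deriv φ s / φ s) * (deriv f s / f s)
          - (deriv φ s / φ s) * deriv h s) * sqNorm ε α = lam / (φ s) ^ 2) ∧
      (∀ s t : ℝ,
        (deriv (deriv f) s * (φ s) ^ 2 * f s
            - ((Fintype.card ι : ℝ) - 2) * deriv φ s * φ s * f s * deriv f s
            + ((Fintype.card κ : ℝ) - 1) * (deriv f s) ^ 2 * (φ s) ^ 2
            - deriv f s * f s * (φ s) ^ 2 * deriv h s) * sqNorm ε α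
          + lam * (f s) ^ 2
        = (τ t * deriv (deriv τ) t - ((Fintype.card κ : ℝ) - 1) * (deriv τ t) ^ 2)
          * sqNorm δ β) ∧
      (∀ t : ℝ,
        ((Fintype.card κ : ℝ) - 2) * (deriv (deriv τ) t / τ t) - θ * (deriv u t) ^ 2 = 0) ∧
      (∀ t : ℝ,
        ((τ t) ^ 2 * deriv (deriv u) t - ((Fintype.card κ : ℝ) - 2) * τ t * deriv τ t * deriv u t)
          * sqNorm δ β = 0)) := by
  have hε' (i : ι) : ε i * ε i = 1 := mul_self_eq_one_iff.2 (hε i)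
  have hδ' (j : κ) : δ j * δ j = 1 := mul_self_eq_one_iff.2 (hδ j)
  have hgB := isSemiRiemannianMetric_conformalMetric hε' (contDiff_comp_linFun hφ α) fun x => hφ0 _
  have hgF := isSemiRiemannianMetric_conformalMetric hδ' (contDiff_comp_linFun hτ β) fun y => hτ0 _
  have hconst : (∃ c : ℝ, ∀ p : ι ⊕ κ → ℝ, u (linFun β (fiberProj p)) = c) ↔
      ∃ c : ℝ, ∀ t, u t = c :=
    exists_congr fun c =>
      (((linFun_surjective hβ).comp fiberProj_surjective).forall (p := (u · = c))).symm
  rw [and_comm, hconst, isGRHS_warpedMetric_iff hgB (contDiff_comp_linFun hf α) (fun x => hf0 _) hgF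
      (contDiff_comp_linFun hh α) (contDiff_comp_linFun hu β) hθ,
    ricci_add_hess_sub_hess_eq_smul_conformalMetric_comp_linFun_iff hε' hφ hφ0 hα hf hh,
    tension_conformalMetric_comp_linFun_eq_zero_iff hδ' hτ hτ0 hβ hu]
  simp only [ricci_sub_eq_smul_conformalMetric_comp_linFun_iff hδ' hτ hτ0 hβ
      (hu.differentiable (by simp)),
    tension_add_metricInner_conformalMetric_comp_linFun hε' hφ hφ0 α hf
      (hh.differentiable (by simp)), forall_and, forall_const, and_assoc]
  refine and_congr_right fun _ => and_congr_right fun _ => and_congr_right fun _ =>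
    and_congr_left fun _ => ?_
  rw [(linFun_surjective hα).forall]

theorem theorem4 (n m : ℕ) (hn : 2 ≤ n) (hm : 2 ≤ m)
    (ε : Fin n → ℝ) (hε : ∀ i, ε i = 1 ∨ ε i = -1)
    (δ : Fin m → ℝ) (hδ : ∀ j, δ j = 1 ∨ δ j = -1)
    (α : Fin n → ℝ) (hα : α ≠ 0) (β : Fin m → ℝ) (hβ : β ≠ 0)
    (θ lam : ℝ) (hθ : 0 ≤ θ)
    (φ f h τ u : ℝ → ℝ)
    (hφ : ContDiff ℝ ∞ φ) (hφ0 : ∀ s, φ s ≠ 0)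
    (hf : ContDiff ℝ ∞ f) (hf0 : ∀ s, 0 < f s)
    (hh : ContDiff ℝ ∞ h)
    (hτ : ContDiff ℝ ∞ τ) (hτ0 : ∀ t, τ t ≠ 0)
    (hu : ContDiff ℝ ∞ u) :
    (GRHS.IsGRHS
        (GRHS.warpedMetric
          (GRHS.conformalMetric ε (fun x => φ (GRHS.linFun α x)))
          (fun x => f (GRHS.linFun α x))
          (GRHS.conformalMetric δ (fun y => τ (GRHS.linFun β y))))
        (fun p => h (GRHS.linFun α (GRHS.baseProj p)))
        (fun p => u (GRHS.linFun β (GRHS.fiberProj p)))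
        θ lam ∧
      ¬ ∃ c : ℝ, ∀ p : Fin n ⊕ Fin m → ℝ, u (GRHS.linFun β (GRHS.fiberProj p)) = c)
    ↔
    ((¬ ∃ c : ℝ, ∀ t, u t = c) ∧
      (∀ s : ℝ,
        ((n : ℝ) - 2) * (deriv (deriv φ) s / φ s) - m * (deriv (deriv f) s / f s)
          - 2 * m * (deriv φ s / φ s) * (deriv f s / f s)
          + deriv (deriv h) s + 2 * (deriv φ s / φ s) * deriv h s = 0) ∧
      (∀ s : ℝ,
        (deriv (deriv φ) s / φ s - ((n : ℝ) - 1) * (deriv φ s / φ s) ^ 2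
          + m * (deriv φ s / φ s) * (deriv f s / f s)
          - (deriv φ s / φ s) * deriv h s) * GRHS.sqNorm ε α = lam / (φ s) ^ 2) ∧
      (∀ s t : ℝ,
        (deriv (deriv f) s * (φ s) ^ 2 * f s
            - ((n : ℝ) - 2) * deriv φ s * φ s * f s * deriv f s
            + ((m : ℝ) - 1) * (deriv f s) ^ 2 * (φ s) ^ 2
            - deriv f s * f s * (φ s) ^ 2 * deriv h s) * GRHS.sqNorm ε α
          + lam * (f s) ^ 2
        = (τ t * deriv (deriv τ) t - ((m : ℝ) - 1) * (deriv τ t) ^ 2) * GRHS.sqNorm δ β) ∧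
      (∀ t : ℝ,
        ((m : ℝ) - 2) * (deriv (deriv τ) t / τ t) - θ * (deriv u t) ^ 2 = 0) ∧
      (∀ t : ℝ,
        ((τ t) ^ 2 * deriv (deriv u) t - ((m : ℝ) - 2) * τ t * deriv τ t * deriv u t)
          * GRHS.sqNorm δ β = 0)) := by
  have := Fin.nontrivial_iff_two_le.2 hn
  have := Fin.nontrivial_iff_two_le.2 hm
  simpa only [Fintype.card_fin] using theorem4_general ε hε δ hδ α hα β hβ θ lam hθ φ f h τ u
    hφ hφ0 hf (fun s => (hf0 s).ne') hh hτ hτ0 hu
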